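/- Let $d\in\mathbb N$ and let $p:\mathbb Z^d\to[0,\infty)$ satisfy $\sum_z p(z)=1$. The exclusion process on $\mathbb Z^d$ with transition probabilities $p(x,y)=p(y-x)$ is the Markov process on $\{0,1\}^{\mathbb Z^d}$ whose semigroup $S(t)$ on $C(\{0,1\}^{\mathbb Z^d})$ is the (existing and unique) Markov semigroup whose generator is the closure of the operator $$Lf(\eta)=\sum_{x,y:\ \eta(x)=1,\ \eta(y)=0}p(x,y)\,[f(\eta^{x,y})-f(\eta)],\qquad f \text{ depending on finitely many coordinates},$$ where $\eta^{x,y}$ is $\eta$ with the values at $x$ and $y$ interchanged. A probability measure $\mu$ is stationary if $\int S(t)f\,d\mu=\int f\,d\mu$ for all $t\ge 0$ and all continuous $f$, and reversible if $\int f\,S(t)g\,d\mu=\int g\,S(t)f\,d\mu$ for all $t\ge0$ and all continuous $f,g$. It is homogeneous if it is invariant under all translations of $\mathbb Z^d$. For $\alpha:\mathbb Z^d\to(0,1)$ let $\nu_\alpha$ be the product measure on $\{0,1\}^{\mathbb Z^d}$ with $\nu_\alpha\{\eta:\eta(x)=1\}=\alpha(x)$, and let $\pi(x)=\alpha(x)/(1-\alpha(x))$.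 Theorem 2. Suppose that $v\in\mathbb R^d$ and $\pi(x)=\pi(0)e^{\langle x,v\rangle}$ for all $x\in\mathbb Z^d$. Then $\nu_\alpha$ is stationary for the exclusion process if and only if $$p(z)=e^{\langle z,v\rangle}p(-z)\quad\text{for all } z\in\mathbb Z^d \text{ such that } \langle z,v\rangle\neq 0.$$ This gives stationary product measures that are neither homogeneous nor reversible. For example, let $d=2$ and let $p(e_i)=p_i>0$, $p(-e_i)=q_i>0$ for $i=1,2$, where $e_1,e_2$ are the standard basis vectors, $p_1+q_1+p_2+q_2=1$, $p_1\ne q_1$ and $p_2\neq q_2$, with $p(z)=0$ for all other $z$. Then, for every $i\in\{1,2\}$ and every $c>0$, the product measure $\nu_\alpha$ with $\pi(x)=c\,(p_i/q_i)^{x^{(i)}}$ is stationary, but it is neither homogeneous nor reversible. -/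

import Mathlib

open MeasureTheory Filter Topology
open scoped NNReal

noncomputable section

namespace Exclusion

/-- Configurations `η ∈ {0,1}^S`: `η x = true` means that the site `x` is occupied.
The topology and the σ-algebra are the product ones. -/
abbrev Config (S : Type*) : Type _ := S → Bool

/-- The configuration `η^{x,y}` in which the values at the sites `x` and `y` are interchanged. -/
def exchange {S : Type*} [DecidableEq S] (η : Config S) (x y : S) : Config S :=
  fun z => η (Equiv.swap x y z)

/-- The contribution of the pair `e = (x, y)` to the generator: at rate `P x y`, a particle at `x`
moves to `y` provided that `y` is vacant. -/
def jumpTerm {S : Type*} [DecidableEq S] (P : S → S → ℝ) (f : Config S → ℝ) (η : Config S)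
    (e : S × S) : ℝ :=
  if η e.1 = true ∧ η e.2 = false then P e.1 e.2 * (f (exchange η e.1 e.2) - f η) else 0

/-- `f` depends on finitely many coordinates. -/
def IsCylinder {S : Type*} (f : Config S → ℝ) : Prop :=
  ∃ A : Finset S, DependsOn f (A : Set S)

/-- The graph of the exclusion pregenerator: the pairs `(f, g)` where `f` depends on finitely many
coordinates and
`g η = ∑_{x, y : η x = 1, η y = 0} P x y * (f (η^{x,y}) - f η)`. -/
def pregeneratorGraph {S : Type*} [DecidableEq S] (P : S → S → ℝ) :
    Set (C(Config S, ℝ) × C(Config S, ℝ)) :=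
  {fg | IsCylinder fg.1 ∧ ∀ η, HasSum (jumpTerm P fg.1 η) (fg.2 η)}

/-- Families of operators on `C({0,1}^S)` indexed by the time `t ≥ 0`. -/
abbrev OperatorFamily (S : Type*) : Type _ := ℝ≥0 → C(Config S, ℝ) →L[ℝ] C(Config S, ℝ)

/-- A Markov (Feller) semigroup on `C({0,1}^S)`. -/
structure IsMarkovSemigroup {S : Type*} (T : OperatorFamily S) : Prop where
  zero : T 0 = ContinuousLinearMap.id ℝ _
  add : ∀ s t, T (s + t) = (T s).comp (T t)
  continuous : ∀ f, Continuous fun t => T t f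
  one : ∀ t, T t 1 = 1
  nonneg : ∀ t f, 0 ≤ f → 0 ≤ T t f

/-- The graph of the infinitesimal generator: the pairs `(f, g)` such that
`(T t f - f) / t → g` uniformly as `t ↓ 0`. -/
def generatorGraph {S : Type*} (T : OperatorFamily S) :
    Set (C(Config S, ℝ) × C(Config S, ℝ)) :=
  {fg | Tendsto (fun t : ℝ≥0 => (t : ℝ)⁻¹ • (T t fg.1 - fg.1)) (𝓝[>] 0) (𝓝 fg.2)}

/-- `T` is the semigroup of the exclusion process with transition probabilities `P`: the Markov
semigroup whose generator is the closure of the exclusion pregenerator. -/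
structure IsExclusionSemigroup {S : Type*} [DecidableEq S] (P : S → S → ℝ)
    (T : OperatorFamily S) : Prop extends IsMarkovSemigroup T where
  generator_eq : generatorGraph T = closure (pregeneratorGraph P)

/-- `μ` is stationary: `μ T(t) = μ` for all `t`, where `μ T(t)` is the law at time `t` of the
process started from `μ`, that is, `∫ f d(μ T(t)) = ∫ T(t) f dμ` for all continuous `f`. -/
def IsStationary {S : Type*} (T : OperatorFamily S) (μ : Measure (Config S)) : Prop :=
  ∀ t f, ∫ η, T t f η ∂μ = ∫ η, f η ∂μ

/-- `μ` is reversible: each `T(t)` is symmetric with respect to `μ`. -/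
def IsReversible {S : Type*} (T : OperatorFamily S) (μ : Measure (Config S)) : Prop :=
  ∀ t f g, ∫ η, f η * T t g η ∂μ = ∫ η, g η * T t f η ∂μ

/-- The product measure `ν_α` with `ν_α {η : η x = 1} = α x`. -/
def productMeasure {S : Type*} (α : S → unitInterval) : Measure (Config S) :=
  Measure.infinitePi fun x => ProbabilityTheory.bernoulliMeasure true false (α x)

/-- `π(x) = α(x) / (1 - α(x))`. -/
def odds {S : Type*} (α : S → unitInterval) (x : S) : ℝ := (α x : ℝ) / (1 - (α x : ℝ))

/-- The integer lattice `ℤ^d`. -/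
abbrev Lattice (d : ℕ) : Type := Fin d → ℤ

/-- The translation invariant kernel `p(x, y) = p(y - x)`. -/
def translationKernel {d : ℕ} (p : Lattice d → ℝ) (x y : Lattice d) : ℝ := p (y - x)

/-- The inner product `⟨x, v⟩` of `x ∈ ℤ^d` and `v ∈ ℝ^d`. -/
def pairing {d : ℕ} (x : Lattice d) (v : Fin d → ℝ) : ℝ := ∑ i, (x i : ℝ) * v i

/-- `μ` is homogeneous: invariant under all translations of `ℤ^d`. -/
def IsHomogeneous {d : ℕ} (μ : Measure (Config (Lattice d))) : Prop :=
  ∀ a : Lattice d, μ.map (fun η x => η (x + a)) = μ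

/-- The nearest neighbour kernel with `p(e_i) = a i`, `p(-e_i) = b i`, and `p(z) = 0` otherwise. -/
def nearestNeighbour {d : ℕ} (a b : Fin d → ℝ) (z : Lattice d) : ℝ :=
  ∑ i, ((if z = Pi.single i 1 then a i else 0) + (if z = -Pi.single i 1 then b i else 0))

end Exclusion

end

/-!
The closure of the exclusion pregenerator generates a unique Markov semigroup, and stationarity of a
product measure is a condition on the means of the generator.

**Existence.** In a finite set `F` of bonds the generator is a bounded operator `volumeOp P F`, and
its exponential is a contraction. A bond `(x, y)` acts by composition with the map `move (x, y)`, so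
that the change of a function caused by flipping one site is controlled along the flow by the
operator `h ↦ (u ↦ ∑ y, (P u y + P y u) h y)`. A summable weight `h` that this operator enlarges at
most fourfold exists because the rates have row and column sums at most `1`
(`exists_isWeight`), and for such a weight the oscillations of `e^{tL_F} f` are at most
`e^{4t} K h`, uniformly in `F` (`HasOscillation.expFlow_volumeOp`). Duhamel's formula
(`norm_expFlow_sub_le`) then shows that the flows `e^{tL_F}` converge strongly. The same estimate
shows that the limit `T` maps functions of finitely many coordinates into the domain of the closed
pregenerator, and since `(∫₀ᵗ T(s) f ds, T(t) f - f)` therefore lies in its graph, the generator of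
`T` is no larger than the closure (`generatorGraph_subset_closure`). A Markov semigroup is
determined by its generator, which gives uniqueness.

**Stationarity.** The product measure `ν_α` is stationary precisely when `∫ L f dν_α = 0` for all
`f` depending on finitely many coordinates. With `w(x, y) = ∫ f 1{η x = 1, η y = 0} dν_α` and
`π = α / (1 - α)`, the bond `(x, y)` contributes `p(y - x) (π(x) / π(y) w(y, x) - w(x, y))`
(`integral_move_sub`). If `p(z) = e^{⟨z, v⟩} p(-z)` whenever `⟨z, v⟩ ≠ 0`, the contributions of
`(x, y)` and `(y, x)` with `⟨y - x, v⟩ ≠ 0` cancel, while those with `⟨y - x, v⟩ = 0` are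
`p(y - x) (m(y) - m(x))` with `m` of finite support, and sum to zero
(`isStationary_of_forall_eq`). Conversely, testing with the product of the centred occupation
variables at `0` and `z` isolates the bond between these two sites and gives the condition at `z`
(`IsStationary.bond_balance`).

**The example.** The criterion holds with `v` parallel to `e_i`. The density is not constant along
`e_i`, so that the measure is not homogeneous; it is constant along the other direction `e_j`, where
reversibility would force `p(e_j) = p(-e_j)` (`IsReversible.detailed_balance`).
-/

noncomputable section

namespace Exclusion

/-! ### Exponentials of bounded operators -/

section ExponentialFlow

variable {E : Type*} [NormedAddCommGroup E] [NormedSpace ℝ E]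

/-- The flow `e^{tA}` of a bounded operator `A` on a Banach space. -/
def expFlow (A : E →L[ℝ] E) (t : ℝ) : E →L[ℝ] E := NormedSpace.exp (t • A)

theorem expFlow_zero (A : E →L[ℝ] E) : expFlow A 0 = ContinuousLinearMap.id ℝ E := by
  simp [expFlow, ContinuousLinearMap.one_def]

variable [CompleteSpace E]

theorem expFlow_add (A : E →L[ℝ] E) (s t : ℝ) (f : E) :
    expFlow A (s + t) f = expFlow A s (expFlow A t f) := by
  let _ : NormedAlgebra ℚ (E →L[ℝ] E) := NormedAlgebra.restrictScalars ℚ ℝ _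
  have hc : Commute (s • A) (t • A) := ((Commute.refl A).smul_left s).smul_right t
  have h := NormedSpace.exp_add_of_commute hc
  rw [expFlow, add_smul, h]
  rfl

theorem hasDerivAt_expFlow (A : E →L[ℝ] E) (f : E) (t : ℝ) :
    HasDerivAt (fun s => expFlow A s f) (expFlow A t (A f)) t := by
  have h := hasDerivAt_exp_smul_const (𝕂 := ℝ) A t
  exact ((ContinuousLinearMap.apply ℝ E f).hasFDerivAt.comp_hasDerivAt t h)

theorem continuous_expFlow (A : E →L[ℝ] E) (f : E) : Continuous fun t => expFlow A t f :=
  continuous_iff_continuousAt.2 fun t => (hasDerivAt_expFlow A f t).continuousAt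

theorem expFlow_apply_comm (A : E →L[ℝ] E) (t : ℝ) (f : E) :
    expFlow A t (A f) = A (expFlow A t f) := by
  have h := hasDerivAt_exp_smul_const (𝕂 := ℝ) A t
  have h' := hasDerivAt_exp_smul_const' (𝕂 := ℝ) A t
  exact DFunLike.congr_fun (h.unique h') f

theorem hasSum_expFlow (A : E →L[ℝ] E) (t : ℝ) (f : E) :
    HasSum (fun n : ℕ => ((n.factorial : ℝ)⁻¹ * t ^ n) • (A ^ n) f) (expFlow A t f) := by
  have h := NormedSpace.exp_series_hasSum_exp' (𝕂 := ℝ) (t • A)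
  have h2 := (ContinuousLinearMap.apply ℝ E f).hasSum h
  convert h2 using 1
  · ext n
    simp [smul_pow, mul_smul]
  · rfl

/-- The derivative of `s ↦ e^{(t-s)A} u(s)`: differentiating such an interpolation compares two
flows. -/
theorem hasDerivAt_expFlow_sub_apply (A : E →L[ℝ] E) {u : ℝ → E} {u' : E} {s : ℝ} (t : ℝ)
    (hu : HasDerivAt u u' s) :
    HasDerivAt (fun s => expFlow A (t - s) (u s)) (expFlow A (t - s) (u' - A (u s))) s := by
  have h2 : HasDerivAt (fun s : ℝ => t - s) (-1) s := by
    simpa using (hasDerivAt_id s).const_sub t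
  have h : HasDerivAt (fun s => expFlow A (t - s)) ((-1 : ℝ) • (expFlow A (t - s) * A)) s :=
    (hasDerivAt_exp_smul_const (𝕂 := ℝ) A (t - s)).scomp s h2
  convert h.clm_apply hu using 1
  simp [sub_eq_neg_add]

/-- **Duhamel's formula**, as an estimate: if `e^{tB}` is a contraction for `t ≥ 0`, then
`e^{tB} f` and `e^{tA} f` differ by at most `t` times a bound for `(A - B) e^{sA} f`. -/
theorem norm_expFlow_sub_le {A B : E →L[ℝ] E} (hB : ∀ t, 0 ≤ t → ∀ f, ‖expFlow B t f‖ ≤ ‖f‖)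
    {f : E} {t C : ℝ} (ht : 0 ≤ t)
    (hC : ∀ s, 0 ≤ s → s ≤ t → ‖A (expFlow A s f) - B (expFlow A s f)‖ ≤ C) :
    ‖expFlow A t f - expFlow B t f‖ ≤ C * t := by
  have key : ∀ s : ℝ, HasDerivAt (fun s => expFlow B (t - s) (expFlow A s f))
      (expFlow B (t - s) (A (expFlow A s f) - B (expFlow A s f))) s := fun s => by
    rw [← expFlow_apply_comm]
    exact hasDerivAt_expFlow_sub_apply B t (hasDerivAt_expFlow A f s)
  have := norm_image_sub_le_of_norm_deriv_le_segment' (f := fun s => expFlow B (t - s)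
      (expFlow A s f)) (a := 0) (b := t) (C := C)
    (fun s _ => (key s).hasDerivWithinAt)
    (fun s hs => (hB _ (by linarith [hs.2]) _).trans (hC s hs.1 hs.2.le)) t ⟨ht, le_rfl⟩
  simpa [expFlow_zero] using this

theorem expFlow_sub_smul (B : E →L[ℝ] E) (c t : ℝ) (f : E) :
    expFlow (B - c • (1 : E →L[ℝ] E)) t f = Real.exp (-(c * t)) • expFlow B t f := by
  -- both sides solve the same linear equation
  have key : ∀ s : ℝ, HasDerivAt
      (fun s => expFlow (B - c • (1 : E →L[ℝ] E)) (t - s) (Real.exp (-(c * s)) • expFlow B s f))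
      0 s := by
    intro s
    have h0 : HasDerivAt (fun s : ℝ => -(c * s)) (-c) s := by
      simpa using (hasDerivAt_id s).const_mul (-c)
    have hu : HasDerivAt (fun s => Real.exp (-(c * s)) • expFlow B s f)
        (Real.exp (-(c * s)) • expFlow B s (B f) + (Real.exp (-(c * s)) * -c) • expFlow B s f) s :=
      h0.exp.smul (hasDerivAt_expFlow B f s)
    convert hasDerivAt_expFlow_sub_apply (B - c • (1 : E →L[ℝ] E)) t hu using 1
    have : ∀ g : E, (B - c • (1 : E →L[ℝ] E)) g = B g - c • g := fun g => by simp
    rw [this, expFlow_apply_comm, map_smul, mul_neg, neg_smul, mul_smul, smul_comm c]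
    simp
  have h := is_const_of_deriv_eq_zero (fun s => (key s).differentiableAt)
    (fun s => (key s).deriv) 0 t
  simpa [expFlow_zero] using h

/-- A linear functional that grows at most geometrically along the powers of `B` grows at most
exponentially along the flow of `B - c`. -/
theorem abs_expFlow_sub_smul_le {B : E →L[ℝ] E} {c r K t : ℝ} (ht : 0 ≤ t) (δ : E →L[ℝ] ℝ) {f : E}
    (h : ∀ n : ℕ, |δ ((B ^ n) f)| ≤ (c + r) ^ n * K) :
    |δ (expFlow (B - c • (1 : E →L[ℝ] E)) t f)| ≤ Real.exp (r * t) * K := by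
  have hs := δ.hasSum (hasSum_expFlow B t f)
  have hexp : HasSum (fun n : ℕ => (n.factorial : ℝ)⁻¹ * ((c + r) * t) ^ n * K)
      (Real.exp ((c + r) * t) * K) := by
    refine HasSum.mul_right K ?_
    have := NormedSpace.expSeries_div_hasSum_exp ((c + r) * t)
    rw [← Real.exp_eq_exp_ℝ] at this
    simpa [div_eq_inv_mul] using this
  have hb : |δ (expFlow B t f)| ≤ Real.exp ((c + r) * t) * K := by
    rw [← hs.tsum_eq, ← Real.norm_eq_abs]
    refine tsum_of_norm_bounded hexp fun n => ?_
    simp only [map_smul, smul_eq_mul, norm_mul, Real.norm_eq_abs]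
    rw [abs_of_nonneg (by positivity), abs_of_nonneg (by positivity), mul_pow]
    calc _ ≤ (n.factorial : ℝ)⁻¹ * t ^ n * ((c + r) ^ n * K) := by gcongr; exact h n
      _ = _ := by ring
  rw [expFlow_sub_smul, map_smul, smul_eq_mul, abs_mul, abs_of_pos (Real.exp_pos _)]
  calc _ ≤ Real.exp (-(c * t)) * (Real.exp ((c + r) * t) * K) := by gcongr
    _ = Real.exp (r * t) * K := by
      rw [← mul_assoc, ← Real.exp_add]; ring_nf

theorem norm_expFlow_sub_smul_le {B : E →L[ℝ] E} {c : ℝ} (hB : ‖B‖ ≤ c) {t : ℝ} (ht : 0 ≤ t)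
    (f : E) : ‖expFlow (B - c • (1 : E →L[ℝ] E)) t f‖ ≤ ‖f‖ := by
  have hc : 0 ≤ c := (norm_nonneg _).trans hB
  obtain ⟨δ, hδ, hδf⟩ := exists_dual_vector'' ℝ (expFlow (B - c • (1 : E →L[ℝ] E)) t f)
  have h := abs_expFlow_sub_smul_le (B := B) (c := c) (r := 0) (K := ‖f‖) ht δ (f := f) fun n => by
    rw [← Real.norm_eq_abs, add_zero]
    calc ‖δ ((B ^ n) f)‖ ≤ ‖δ‖ * ‖(B ^ n) f‖ := δ.le_opNorm _
      _ ≤ 1 * (‖B ^ n‖ * ‖f‖) := by gcongr; exact (B ^ n).le_opNorm _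
      _ ≤ 1 * (c ^ n * ‖f‖) := by
        gcongr
        induction n with
        | zero => rw [pow_zero, pow_zero]; exact ContinuousLinearMap.norm_id_le
        | succ n ih =>
          rw [pow_succ, pow_succ]
          exact (norm_mul_le _ _).trans (by gcongr)
      _ = _ := one_mul _
  rw [hδf] at h
  simpa using h

theorem expFlow_apply_mem {A : E →L[ℝ] E} {V : Submodule ℝ E} (hV : IsClosed (V : Set E))
    (hA : ∀ f ∈ V, A f ∈ V) (t : ℝ) {f : E} (hf : f ∈ V) : expFlow A t f ∈ V := by
  have hpow : ∀ n : ℕ, (A ^ n) f ∈ V := by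
    intro n
    induction n with
    | zero => simpa using hf
    | succ n ih => rw [pow_succ']; exact hA _ ih
  exact hV.mem_of_tendsto (hasSum_expFlow A t f)
    (Eventually.of_forall fun s => V.sum_mem fun n _ => V.smul_mem _ (hpow n))

theorem expFlow_apply_of_map_eq_zero {A : E →L[ℝ] E} {f : E} (h : A f = 0) (t : ℝ) :
    expFlow A t f = f := by
  have := is_const_of_deriv_eq_zero (fun s => (hasDerivAt_expFlow A f s).differentiableAt)
    (fun s => by rw [(hasDerivAt_expFlow A f s).deriv, h, map_zero]) t 0
  simpa [expFlow_zero] using this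

theorem integral_expFlow (A : E →L[ℝ] E) (f : E) (t : ℝ) :
    ∫ s in (0 : ℝ)..t, expFlow A s (A f) = expFlow A t f - f := by
  rw [intervalIntegral.integral_eq_sub_of_hasDerivAt (fun s _ => hasDerivAt_expFlow A f s)
    ((continuous_expFlow A (A f)).intervalIntegrable _ _)]
  simp [expFlow_zero]

end ExponentialFlow

section FiniteVolume

variable {S : Type*} [DecidableEq S]

/-! ### Elementary jumps -/

/-- The configuration after an attempted jump along `e = (x, y)`: a particle at `x` moves to `y` if
`y` is vacant, and nothing happens otherwise. -/
def move (e : S × S) (η : Config S) : Config S :=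
  if η e.1 = true ∧ η e.2 = false then exchange η e.1 e.2 else η

theorem move_apply_of_ne {e : S × S} {x : S} (h1 : x ≠ e.1) (h2 : x ≠ e.2) (η : Config S) :
    move e η x = η x := by
  unfold move
  split_ifs
  · simp [exchange, Equiv.swap_apply_of_ne_of_ne h1 h2]
  · rfl

theorem move_apply_congr {e : S × S} {η ζ : Config S} (h1 : η e.1 = ζ e.1) (h2 : η e.2 = ζ e.2)
    {x : S} (hx : η x = ζ x) : move e η x = move e ζ x := by
  unfold move
  rw [h1, h2]
  split_ifs
  · simp only [exchange]
    by_cases hx1 : x = e.1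
    · simp [hx1, h2]
    by_cases hx2 : x = e.2
    · simp [hx2, h1]
    · simp [Equiv.swap_apply_of_ne_of_ne hx1 hx2, hx]
  · exact hx

theorem continuous_move (e : S × S) : Continuous (move e) := by
  unfold move
  have hc : IsClopen {η : Config S | η e.1 = true ∧ η e.2 = false} :=
    ((isClopen_discrete {true}).preimage (continuous_apply e.1)).inter
      ((isClopen_discrete {false}).preimage (continuous_apply e.2))
  refine Continuous.if (fun η hη => ?_) ?_ continuous_id
  · rw [hc.frontier_eq] at hη
    exact hη.elim
  · exact continuous_pi fun z => continuous_apply _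

/-- The operator `f ↦ f ∘ move e`. -/
def moveOp (e : S × S) : C(Config S, ℝ) →L[ℝ] C(Config S, ℝ) :=
  LinearMap.mkContinuous
    { toFun := fun f => f.comp ⟨move e, continuous_move e⟩
      map_add' := fun _ _ => rfl
      map_smul' := fun _ _ => rfl } 1 fun f => by
    rw [one_mul]
    exact (ContinuousMap.norm_le _ (norm_nonneg f)).2 fun η => f.norm_coe_le_norm _

@[simp] theorem moveOp_apply (e : S × S) (f : C(Config S, ℝ)) (η : Config S) :
    moveOp e f η = f (move e η) := rfl

theorem norm_moveOp_le (e : S × S) : ‖moveOp e‖ ≤ 1 :=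
  LinearMap.mkContinuous_norm_le _ zero_le_one _

/-- The contribution of the pair `e` to the generator, as a bounded operator. -/
def jumpOp (P : S → S → ℝ) (e : S × S) : C(Config S, ℝ) →L[ℝ] C(Config S, ℝ) :=
  P e.1 e.2 • (moveOp e - 1)

theorem jumpOp_apply (P : S → S → ℝ) (e : S × S) (f : C(Config S, ℝ)) (η : Config S) :
    jumpOp P e f η = P e.1 e.2 * (f (move e η) - f η) := rfl

theorem jumpTerm_eq (P : S → S → ℝ) (f : C(Config S, ℝ)) (η : Config S) (e : S × S) :
    jumpTerm P f η e = jumpOp P e f η := by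
  rw [jumpTerm, jumpOp_apply, move]
  split_ifs <;> simp

/-- The generator restricted to a finite set of pairs. -/
def volumeOp (P : S → S → ℝ) (F : Finset (S × S)) : C(Config S, ℝ) →L[ℝ] C(Config S, ℝ) :=
  ∑ e ∈ F, jumpOp P e

theorem volumeOp_apply (P : S → S → ℝ) (F : Finset (S × S)) (f : C(Config S, ℝ)) :
    volumeOp P F f = ∑ e ∈ F, jumpOp P e f := by
  simp [volumeOp]

theorem volumeOp_eq (P : S → S → ℝ) (F : Finset (S × S)) :
    volumeOp P F = ∑ e ∈ F, P e.1 e.2 • moveOp e -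
      (∑ e ∈ F, P e.1 e.2) • (1 : C(Config S, ℝ) →L[ℝ] C(Config S, ℝ)) := by
  simp only [volumeOp, jumpOp, smul_sub, Finset.sum_sub_distrib, Finset.sum_smul]

theorem norm_expFlow_volumeOp_le {P : S → S → ℝ} (hP : ∀ x y, 0 ≤ P x y) (F : Finset (S × S))
    {t : ℝ} (ht : 0 ≤ t) (f : C(Config S, ℝ)) : ‖expFlow (volumeOp P F) t f‖ ≤ ‖f‖ := by
  rw [volumeOp_eq]
  refine norm_expFlow_sub_smul_le ((norm_sum_le _ _).trans (Finset.sum_le_sum fun e _ => ?_)) ht f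
  rw [norm_smul, Real.norm_eq_abs, abs_of_nonneg (hP _ _)]
  exact mul_le_of_le_one_right (hP _ _) (norm_moveOp_le e)

theorem expFlow_volumeOp_one (P : S → S → ℝ) (F : Finset (S × S)) (t : ℝ) :
    expFlow (volumeOp P F) t 1 = 1 := by
  refine expFlow_apply_of_map_eq_zero ?_ t
  rw [volumeOp_apply]
  exact Finset.sum_eq_zero fun e _ => by ext η; simp [jumpOp_apply]

/-! ### Functions of finitely many coordinates -/

/-- The continuous functions that depend only on the coordinates in `A`. -/
def dependingOn (A : Set S) : Submodule ℝ C(Config S, ℝ) where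
  carrier := {f | DependsOn f A}
  add_mem' := fun hf hg η ζ h => by simp [hf h, hg h]
  zero_mem' := fun _ _ _ => rfl
  smul_mem' := fun c f hf η ζ h => by simp [hf h]

theorem mem_dependingOn {S : Type*} {A : Set S} {f : C(Config S, ℝ)} :
    f ∈ dependingOn A ↔ DependsOn f A := Iff.rfl

theorem isClosed_dependingOn {S : Type*} (A : Set S) : IsClosed (dependingOn A : Set C(Config S, ℝ)) := by
  have : (dependingOn A : Set C(Config S, ℝ)) =
      ⋂ (η : Config S) (ζ : Config S) (_ : ∀ x ∈ A, η x = ζ x), {f | f η = f ζ} := by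
    ext f
    simp only [Set.mem_iInter, Set.mem_ofPred_eq, SetLike.mem_coe, mem_dependingOn]
    exact ⟨fun h η ζ hx => h hx, fun h η ζ hx => h η ζ hx⟩
  rw [this]
  exact isClosed_iInter fun η => isClosed_iInter fun ζ => isClosed_iInter fun _ =>
    isClosed_eq (by fun_prop) (by fun_prop)

theorem jumpOp_mem_dependingOn (P : S → S → ℝ) {A : Set S} {e : S × S} (h1 : e.1 ∈ A)
    (h2 : e.2 ∈ A) {f : C(Config S, ℝ)} (hf : f ∈ dependingOn A) : jumpOp P e f ∈ dependingOn A := by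
  intro η ζ h
  rw [jumpOp_apply, jumpOp_apply, hf h,
    hf fun x hx => move_apply_congr (h _ h1) (h _ h2) (h x hx)]

theorem isCylinder_expFlow_volumeOp (P : S → S → ℝ) (F : Finset (S × S)) (t : ℝ)
    {f : C(Config S, ℝ)} (hf : IsCylinder f) : IsCylinder (expFlow (volumeOp P F) t f) := by
  obtain ⟨A, hA⟩ := hf
  set B : Finset S := A ∪ (F.image Prod.fst ∪ F.image Prod.snd)
  refine ⟨B, expFlow_apply_mem (isClosed_dependingOn (B : Set S)) (fun g hg => ?_) t
    (DependsOn.mono (by simp [B]) hA : f ∈ dependingOn (B : Set S))⟩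
  rw [volumeOp_apply]
  refine Submodule.sum_mem _ fun e he => jumpOp_mem_dependingOn P ?_ ?_ hg
  · exact Finset.mem_union_right _ (Finset.mem_union_left _ (Finset.mem_image_of_mem _ he))
  · exact Finset.mem_union_right _ (Finset.mem_union_right _ (Finset.mem_image_of_mem _ he))

/-- The algebra of continuous functions depending on finitely many coordinates. -/
def cylinderAlgebra (S : Type*) : Subalgebra ℝ C(Config S, ℝ) where
  carrier := {f | IsCylinder f}
  mul_mem' := by
    classical
    rintro f g ⟨A, hA⟩ ⟨B, hB⟩
    refine ⟨A ∪ B, fun η ζ h => ?_⟩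
    have h1 := hA fun x hx => h x (Finset.mem_union_left _ hx)
    have h2 := hB fun x hx => h x (Finset.mem_union_right _ hx)
    simp [h1, h2]
  add_mem' := by
    classical
    rintro f g ⟨A, hA⟩ ⟨B, hB⟩
    refine ⟨A ∪ B, fun η ζ h => ?_⟩
    have h1 := hA fun x hx => h x (Finset.mem_union_left _ hx)
    have h2 := hB fun x hx => h x (Finset.mem_union_right _ hx)
    simp [h1, h2]
  algebraMap_mem' := fun r => ⟨∅, fun _ _ _ => rfl⟩

theorem dense_isCylinder (S : Type*) : Dense {f : C(Config S, ℝ) | IsCylinder f} := by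
  have h : (cylinderAlgebra S).topologicalClosure = ⊤ := by
    refine ContinuousMap.subalgebra_topologicalClosure_eq_top_of_separatesPoints _ ?_
    intro η ζ hne
    obtain ⟨x, hx⟩ := Function.ne_iff.1 hne
    refine ⟨_, ⟨⟨fun ξ => if ξ x = true then 1 else 0,
      (continuous_of_discreteTopology (f := fun b : Bool => if b = true then (1 : ℝ) else 0)).comp
        (continuous_apply x)⟩, ⟨{x}, fun ξ ξ' h => ?_⟩, rfl⟩, ?_⟩
    · simp [h x (by simp)]
    · revert hx
      cases h1 : η x <;> cases h2 : ζ x <;> simp [h1, h2]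
  intro f
  have : f ∈ (cylinderAlgebra S).topologicalClosure := by rw [h]; trivial
  exact this

/-! ### Weighted oscillations -/

/-- `f` changes by at most `K * h u` when the configuration is changed at the single site `u`. -/
def HasOscillation (h : S → ℝ) (K : ℝ) (f : C(Config S, ℝ)) : Prop :=
  ∀ (u : S) (η ζ : Config S), (∀ x, x ≠ u → η x = ζ x) → |f η - f ζ| ≤ K * h u

theorem HasOscillation.abs_sub_le {h : S → ℝ} {K : ℝ} {f : C(Config S, ℝ)}
    (hf : HasOscillation h K f) {u v : S} {η ζ : Config S}
    (hηζ : ∀ x, x ≠ u → x ≠ v → η x = ζ x) : |f η - f ζ| ≤ K * (h u + h v) := by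
  have h1 := hf u η (Function.update η u (ζ u)) fun x hx => by simp [hx]
  have h2 := hf v (Function.update η u (ζ u)) ζ fun x hx => by
    by_cases hxu : x = u
    · subst hxu; simp
    · simp [hxu, hηζ x hxu hx]
  calc |f η - f ζ| ≤ _ := _root_.abs_sub_le _ (f (Function.update η u (ζ u))) _
    _ ≤ K * h u + K * h v := add_le_add h1 h2
    _ = _ := by ring

/-- A weight for the rates `P`: a nonnegative function `h` for which the total rate
`∑ P x y (h x + h y)` is finite, and which the influence operator
`h ↦ (u ↦ ∑ y, (P u y + P y u) h y)` enlarges at most by the factor `4`. -/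
structure IsWeight (P : S → S → ℝ) (h : S → ℝ) : Prop where
  nonneg : ∀ x, 0 ≤ h x
  sum_le : ∀ (u : S) (F : Finset (S × S)),
    ∑ e ∈ F, P e.1 e.2 * ((if u = e.1 then h e.2 else 0) + (if u = e.2 then h e.1 else 0))
      ≤ 4 * h u
  summable : Summable fun e : S × S => P e.1 e.2 * (h e.1 + h e.2)

variable {P : S → S → ℝ} {h : S → ℝ} {K : ℝ} {f : C(Config S, ℝ)}

theorem HasOscillation.norm_jumpOp_le (hP : ∀ x y, 0 ≤ P x y) (hh : IsWeight P h) (hK : 0 ≤ K)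
    (hf : HasOscillation h K f) (e : S × S) :
    ‖jumpOp P e f‖ ≤ K * (P e.1 e.2 * (h e.1 + h e.2)) := by
  have hw := mul_nonneg (hP e.1 e.2) (add_nonneg (hh.nonneg e.1) (hh.nonneg e.2))
  refine (ContinuousMap.norm_le _ (mul_nonneg hK hw)).2 fun η => ?_
  rw [jumpOp_apply, Real.norm_eq_abs, abs_mul, abs_of_nonneg (hP _ _), mul_left_comm]
  exact mul_le_mul_of_nonneg_left
    (hf.abs_sub_le fun x h1 h2 => move_apply_of_ne h1 h2 η) (hP _ _)

theorem HasOscillation.moveOp (hh : ∀ x, 0 ≤ h x) (hK : 0 ≤ K) (hf : HasOscillation h K f)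
    (e : S × S) {u : S} {η ζ : Config S} (hηζ : ∀ x, x ≠ u → η x = ζ x) :
    |moveOp e f η - moveOp e f ζ| ≤
      K * (h u + ((if u = e.1 then h e.2 else 0) + (if u = e.2 then h e.1 else 0))) := by
  rw [moveOp_apply, moveOp_apply]
  by_cases h1 : u = e.1
  · refine (hf.abs_sub_le (u := e.1) (v := e.2) fun x hx1 hx2 => ?_).trans ?_
    · rw [move_apply_of_ne hx1 hx2, move_apply_of_ne hx1 hx2, hηζ x (h1 ▸ hx1)]
    · gcongr
      · rw [h1]
      · rw [if_pos h1]
        split_ifs <;> simp [hh]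
  by_cases h2 : u = e.2
  · refine (hf.abs_sub_le (u := e.2) (v := e.1) fun x hx1 hx2 => ?_).trans ?_
    · rw [move_apply_of_ne hx2 hx1, move_apply_of_ne hx2 hx1, hηζ x (h2 ▸ hx1)]
    · gcongr
      · rw [h2]
      · rw [if_pos h2, if_neg h1, zero_add]
  · rw [if_neg h1, if_neg h2, add_zero, add_zero]
    exact hf u _ _ fun x hx => move_apply_congr (hηζ _ (Ne.symm h1)) (hηζ _ (Ne.symm h2)) (hηζ x hx)

/-- The finite volume flows increase weighted oscillations at most by the factor `e^{4t}`,
uniformly in the volume. -/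
theorem HasOscillation.expFlow_volumeOp (hP : ∀ x y, 0 ≤ P x y) (hh : IsWeight P h) (hK : 0 ≤ K)
    (hf : HasOscillation h K f) (F : Finset (S × S)) {t : ℝ} (ht : 0 ≤ t) :
    HasOscillation h (Real.exp (4 * t) * K) (expFlow (volumeOp P F) t f) := by
  set B : C(Config S, ℝ) →L[ℝ] C(Config S, ℝ) := ∑ e ∈ F, P e.1 e.2 • Exclusion.moveOp e with hB
  set c : ℝ := ∑ e ∈ F, P e.1 e.2 with hc
  have hc0 : 0 ≤ c := Finset.sum_nonneg fun e _ => hP _ _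
  have hstep : ∀ (K : ℝ) (g : C(Config S, ℝ)), 0 ≤ K → HasOscillation h K g →
      HasOscillation h ((c + 4) * K) (B g) := by
    intro K g hK hg u η ζ hηζ
    have hBg : ∀ ξ, B g ξ = ∑ e ∈ F, P e.1 e.2 * Exclusion.moveOp e g ξ := fun ξ => by simp [hB]
    rw [hBg, hBg, ← Finset.sum_sub_distrib]
    calc |∑ e ∈ F, (P e.1 e.2 * Exclusion.moveOp e g η - P e.1 e.2 * Exclusion.moveOp e g ζ)|
        ≤ ∑ e ∈ F, P e.1 e.2 * (K * (h u +
            ((if u = e.1 then h e.2 else 0) + (if u = e.2 then h e.1 else 0)))) := by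
          refine (Finset.abs_sum_le_sum_abs _ _).trans (Finset.sum_le_sum fun e _ => ?_)
          rw [← mul_sub, abs_mul, abs_of_nonneg (hP _ _)]
          exact mul_le_mul_of_nonneg_left (hg.moveOp hh.nonneg hK e hηζ) (hP _ _)
      _ = K * (c * h u + ∑ e ∈ F, P e.1 e.2 *
            ((if u = e.1 then h e.2 else 0) + (if u = e.2 then h e.1 else 0))) := by
          rw [hc, Finset.sum_mul, ← Finset.sum_add_distrib, Finset.mul_sum]
          exact Finset.sum_congr rfl fun e _ => by ring
      _ ≤ K * (c * h u + 4 * h u) := by gcongr; exact hh.sum_le u F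
      _ = (c + 4) * K * h u := by ring
  have hpow : ∀ n : ℕ, HasOscillation h ((c + 4) ^ n * K) ((B ^ n) f) := by
    intro n
    induction n with
    | zero => simpa using hf
    | succ n ih =>
      rw [pow_succ', pow_succ', mul_assoc]
      exact hstep _ _ (by positivity) ih
  intro u η ζ hηζ
  rw [volumeOp_eq, mul_assoc]
  refine abs_expFlow_sub_smul_le ht
    (ContinuousMap.evalCLM ℝ η - ContinuousMap.evalCLM ℝ ζ) fun n => ?_
  rw [← mul_assoc]
  exact hpow n u η ζ hηζ

end FiniteVolume

/-! ### Existence of weights -/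

section Weights

variable {S : Type*}

/-- Nonnegative rates whose row and column sums are at most `1`. -/
structure IsDoublySubstochastic (P : S → S → ℝ) : Prop where
  nonneg : ∀ x y, 0 ≤ P x y
  row : ∀ x, ∑' y, ENNReal.ofReal (P x y) ≤ 1
  col : ∀ y, ∑' x, ENNReal.ofReal (P x y) ≤ 1

/-- The influence operator `k ↦ (u ↦ ∑ y, (P u y + P y u) k y)`. -/
def influence (P : S → S → ℝ) (k : S → ENNReal) (u : S) : ENNReal :=
  ∑' y, (ENNReal.ofReal (P u y) + ENNReal.ofReal (P y u)) * k y

variable {P : S → S → ℝ}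

theorem tsum_influence_le (hP : IsDoublySubstochastic P) (k : S → ENNReal) :
    ∑' u, influence P k u ≤ 2 * ∑' u, k u := by
  unfold influence
  rw [ENNReal.tsum_comm, ← ENNReal.tsum_mul_left]
  refine ENNReal.tsum_le_tsum fun y => ?_
  rw [ENNReal.tsum_mul_right, ENNReal.tsum_add]
  gcongr
  calc _ ≤ (1 : ENNReal) + 1 := add_le_add (hP.col y) (hP.row y)
    _ = 2 := one_add_one_eq_two

/-- The resolvent `∑ₙ 4⁻ⁿ Γⁿ k` of the influence operator `Γ`. -/
def influenceResolvent (P : S → S → ℝ) (k : S → ENNReal) (u : S) : ENNReal :=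
  ∑' n : ℕ, (4 : ENNReal)⁻¹ ^ n * ((influence P)^[n] k) u

theorem le_influenceResolvent (k : S → ENNReal) (u : S) : k u ≤ influenceResolvent P k u := by
  simpa [influenceResolvent] using ENNReal.le_tsum
    (f := fun n : ℕ => (4 : ENNReal)⁻¹ ^ n * ((influence P)^[n] k) u) 0

theorem influence_influenceResolvent_le (k : S → ENNReal) (u : S) :
    influence P (influenceResolvent P k) u ≤ 4 * influenceResolvent P k u := by
  have h1 : influence P (influenceResolvent P k) u =
      ∑' n : ℕ, (4 : ENNReal)⁻¹ ^ n * ((influence P)^[n + 1] k) u := by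
    simp only [Function.iterate_succ_apply']
    simp only [influence, influenceResolvent, ← ENNReal.tsum_mul_left]
    rw [ENNReal.tsum_comm]
    exact tsum_congr fun n => tsum_congr fun y => by ring
  have h2 : ∀ n : ℕ, (4 : ENNReal)⁻¹ ^ n * ((influence P)^[n + 1] k) u =
      4 * ((4 : ENNReal)⁻¹ ^ (n + 1) * ((influence P)^[n + 1] k) u) := fun n => by
    rw [pow_succ', ← mul_assoc, ← mul_assoc, ENNReal.mul_inv_cancel (by norm_num) (by norm_num),
      one_mul]
  rw [h1, influenceResolvent]
  simp only [h2]
  rw [ENNReal.tsum_mul_left]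
  refine mul_le_mul_right ?_ 4
  exact ENNReal.tsum_comp_le_tsum_of_injective Nat.succ_injective
    fun n : ℕ => (4 : ENNReal)⁻¹ ^ n * ((influence P)^[n] k) u

theorem tsum_influenceResolvent_le (hP : IsDoublySubstochastic P) (k : S → ENNReal) :
    ∑' u, influenceResolvent P k u ≤ 2 * ∑' u, k u := by
  have hpow : ∀ n : ℕ, ∑' u, ((influence P)^[n] k) u ≤ 2 ^ n * ∑' u, k u := by
    intro n
    induction n with
    | zero => simp
    | succ n ih =>
      rw [Function.iterate_succ_apply', pow_succ', mul_assoc]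
      exact (tsum_influence_le hP _).trans (by gcongr)
  unfold influenceResolvent
  rw [ENNReal.tsum_comm]
  have h42 : (4 : ENNReal)⁻¹ * 2 = 2⁻¹ := by
    rw [show (4 : ENNReal) = 2 * 2 by norm_num, ENNReal.mul_inv (by norm_num) (by norm_num),
      mul_assoc, ENNReal.inv_mul_cancel (by norm_num) (by norm_num), mul_one]
  calc ∑' (n : ℕ) (u : S), (4 : ENNReal)⁻¹ ^ n * ((influence P)^[n] k) u
      ≤ ∑' n : ℕ, (2 : ENNReal)⁻¹ ^ n * ∑' u, k u := by
        refine ENNReal.tsum_le_tsum fun n => ?_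
        rw [ENNReal.tsum_mul_left, ← h42, mul_pow, mul_assoc]
        gcongr
        exact hpow n
    _ = 2 * ∑' u, k u := by
        rw [ENNReal.tsum_mul_right, ENNReal.tsum_geometric, ENNReal.one_sub_inv_two, inv_inv]

variable [DecidableEq S]

theorem exists_isWeight (hP : IsDoublySubstochastic P) (A : Finset S) :
    ∃ h, IsWeight P h ∧ ∀ x ∈ A, 1 ≤ h x := by
  set k : S → ENNReal := fun x => if x ∈ A then 1 else 0 with hk
  set H := influenceResolvent P k with hH
  have hsum : ∑' u, H u ≠ ⊤ := by
    refine ne_top_of_le_ne_top ?_ (tsum_influenceResolvent_le hP k)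
    refine ENNReal.mul_ne_top (by norm_num) ?_
    rw [tsum_eq_sum (s := A) fun x hx => by simp [hk, hx]]
    simp [hk]
  have hfin : ∀ x, H x ≠ ⊤ := fun x => ne_top_of_le_ne_top hsum (ENNReal.le_tsum x)
  have hP' : ∀ x y, P x y = (ENNReal.ofReal (P x y)).toReal := fun x y =>
    (ENNReal.toReal_ofReal (hP.nonneg x y)).symm
  refine ⟨fun x => (H x).toReal, ⟨fun x => ENNReal.toReal_nonneg, fun u F => ?_, ?_⟩,
    fun x hx => ?_⟩
  · set Q : S × S → ENNReal := fun e => ENNReal.ofReal (P e.1 e.2) *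
      ((if u = e.1 then H e.2 else 0) + (if u = e.2 then H e.1 else 0)) with hQ
    have hQfin : ∀ e, Q e ≠ ⊤ := fun e => by
      refine ENNReal.mul_ne_top ENNReal.ofReal_ne_top (ENNReal.add_ne_top.2 ⟨?_, ?_⟩) <;>
      · split_ifs
        · exact hfin _
        · exact ENNReal.zero_ne_top
    have h1 : ∑ e ∈ F, Q e ≤ 4 * H u := by
      calc ∑ e ∈ F, Q e ≤ ∑' e, Q e := ENNReal.sum_le_tsum F
        _ = ∑' x, ∑' y, Q (x, y) := ENNReal.tsum_prod' ..
        _ = (∑' x, ∑' y, if u = x then ENNReal.ofReal (P x y) * H y else 0) +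
            ∑' x, ∑' y, if u = y then ENNReal.ofReal (P x y) * H x else 0 := by
          simp only [hQ, mul_add, ENNReal.tsum_add, mul_ite, mul_zero]
        _ = influence P H u := by
          rw [influence]
          simp only [add_mul, ENNReal.tsum_add]
          congr 1
          · rw [tsum_eq_single u fun x hx => by simp [hx.symm]]
            simp
          · exact tsum_congr fun x => by simp
        _ ≤ 4 * H u := influence_influenceResolvent_le k u
    have h2 := ENNReal.toReal_mono (ENNReal.mul_ne_top (by norm_num) (hfin u)) h1
    rw [ENNReal.toReal_sum fun e _ => hQfin e, ENNReal.toReal_mul] at h2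
    refine le_trans (le_of_eq (Finset.sum_congr rfl fun e _ => ?_)) h2
    rw [hQ, ENNReal.toReal_mul, ← hP', ENNReal.toReal_add]
    · congr 2 <;> split_ifs <;> simp
    all_goals
      split_ifs
      · exact hfin _
      · exact ENNReal.zero_ne_top
  · have h1 : ∑' e : S × S, ENNReal.ofReal (P e.1 e.2) * (H e.1 + H e.2) ≠ ⊤ := by
      refine ne_top_of_le_ne_top (ENNReal.add_ne_top.2 ⟨hsum, hsum⟩) ?_
      simp only [mul_add, ENNReal.tsum_add]
      gcongr
      · rw [ENNReal.tsum_prod']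
        refine ENNReal.tsum_le_tsum fun x => ?_
        dsimp only
        rw [ENNReal.tsum_mul_right]
        exact mul_le_of_le_one_left zero_le (hP.row x)
      · rw [ENNReal.tsum_prod', ENNReal.tsum_comm]
        refine ENNReal.tsum_le_tsum fun y => ?_
        dsimp only
        rw [ENNReal.tsum_mul_right]
        exact mul_le_of_le_one_left zero_le (hP.col y)
    refine (ENNReal.summable_toReal h1).congr fun e => ?_
    rw [ENNReal.toReal_mul, ← hP', ENNReal.toReal_add (hfin _) (hfin _)]
  · have := ENNReal.toReal_mono (hfin x) (le_influenceResolvent (P := P) k x)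
    simpa [hk, hx] using this

theorem IsCylinder.exists_hasOscillation (hP : IsDoublySubstochastic P) {f : C(Config S, ℝ)}
    (hf : IsCylinder f) : ∃ h, IsWeight P h ∧ ∃ K, 0 ≤ K ∧ HasOscillation h K f := by
  obtain ⟨A, hA⟩ := hf
  obtain ⟨h, hh, h1⟩ := exists_isWeight hP A
  refine ⟨h, hh, 2 * ‖f‖, by positivity, fun u η ζ hηζ => ?_⟩
  by_cases hu : u ∈ A
  · calc |f η - f ζ| ≤ |f η| + |f ζ| := abs_sub _ _
      _ ≤ ‖f‖ + ‖f‖ := add_le_add (f.norm_coe_le_norm η) (f.norm_coe_le_norm ζ)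
      _ = 2 * ‖f‖ * 1 := by ring
      _ ≤ 2 * ‖f‖ * h u := by gcongr; exact h1 u hu
  · rw [hA fun x hx => hηζ x fun hxu => hu (hxu ▸ hx), sub_self, abs_zero]
    exact mul_nonneg (by positivity) (hh.nonneg u)

end Weights

/-! ### Markov semigroups and their generators -/

section MarkovSemigroup

variable {S : Type*} {T T' : OperatorFamily S}

theorem IsMarkovSemigroup.norm_apply_le (hT : IsMarkovSemigroup T) (t : ℝ≥0) (f : C(Config S, ℝ)) :
    ‖T t f‖ ≤ ‖f‖ := by
  have hone : T t (‖f‖ • (1 : C(Config S, ℝ))) = ‖f‖ • (1 : C(Config S, ℝ)) := by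
    rw [map_smul, hT.one]
  have h1 := hT.nonneg t (‖f‖ • 1 - f) fun η => by
    have := (abs_le.1 (f.norm_coe_le_norm η)).2
    change (0 : ℝ) ≤ ‖f‖ * 1 - f η
    linarith
  have h2 := hT.nonneg t (‖f‖ • 1 + f) fun η => by
    have := (abs_le.1 (f.norm_coe_le_norm η)).1
    change (0 : ℝ) ≤ ‖f‖ * 1 + f η
    linarith
  rw [map_sub, hone] at h1
  rw [map_add, hone] at h2
  refine (ContinuousMap.norm_le _ (norm_nonneg f)).2 fun η => abs_le.2 ?_
  have h1' : (0 : ℝ) ≤ ‖f‖ * 1 - T t f η := h1 η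
  have h2' : (0 : ℝ) ≤ ‖f‖ * 1 + T t f η := h2 η
  exact ⟨by linarith, by linarith⟩

theorem nonneg_of_norm_apply_le {L : C(Config S, ℝ) →L[ℝ] C(Config S, ℝ)}
    (hL : ∀ f, ‖L f‖ ≤ ‖f‖) (h1 : L 1 = 1) {f : C(Config S, ℝ)} (hf : 0 ≤ f) : 0 ≤ L f := by
  intro η
  have hle : ‖‖f‖ • (1 : C(Config S, ℝ)) - f‖ ≤ ‖f‖ := by
    refine (ContinuousMap.norm_le _ (norm_nonneg f)).2 fun ζ => ?_
    have ha := (abs_le.1 (f.norm_coe_le_norm ζ)).2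
    have hb : (0 : ℝ) ≤ f ζ := hf ζ
    change |‖f‖ * 1 - f ζ| ≤ ‖f‖
    exact abs_le.2 ⟨by linarith, by linarith⟩
  have h := ((L (‖f‖ • 1 - f)).norm_coe_le_norm η).trans ((hL _).trans hle)
  rw [map_sub, map_smul, h1] at h
  have h' : ‖f‖ * 1 - L f η ≤ ‖f‖ := (abs_le.1 h).2
  change (0 : ℝ) ≤ L f η
  linarith

theorem IsMarkovSemigroup.tendsto_apply (hT : IsMarkovSemigroup T) {ι : Type*} {l : Filter ι}
    {a : ι → ℝ≥0} {t : ℝ≥0} {u : ι → C(Config S, ℝ)} {f : C(Config S, ℝ)} (ha : Tendsto a l (𝓝 t))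
    (hu : Tendsto u l (𝓝 f)) : Tendsto (fun i => T (a i) (u i)) l (𝓝 (T t f)) := by
  have h1 : Tendsto (fun i => T (a i) f) l (𝓝 (T t f)) := ((hT.continuous f).tendsto t).comp ha
  have h2 : Tendsto (fun i => T (a i) (u i - f)) l (𝓝 0) := by
    refine squeeze_zero_norm (fun i => hT.norm_apply_le _ _) ?_
    simpa using (hu.sub_const f).norm
  simpa using h2.add h1

theorem IsMarkovSemigroup.continuous_apply (hT : IsMarkovSemigroup T) {X : Type*}
    [TopologicalSpace X] {a : X → ℝ≥0} {u : X → C(Config S, ℝ)} (ha : Continuous a)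
    (hu : Continuous u) : Continuous fun x => T (a x) (u x) :=
  continuous_iff_continuousAt.2 fun x => hT.tendsto_apply (ha.tendsto x) (hu.tendsto x)

theorem IsMarkovSemigroup.add_apply (hT : IsMarkovSemigroup T) (s t : ℝ≥0)
    (f : C(Config S, ℝ)) : T (s + t) f = T s (T t f) := by
  rw [hT.add]; rfl

theorem IsMarkovSemigroup.apply_mem_generatorGraph (hT : IsMarkovSemigroup T)
    {f g : C(Config S, ℝ)} (h : (f, g) ∈ generatorGraph T) (s : ℝ≥0) :
    (T s f, T s g) ∈ generatorGraph T := by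
  have h' := ((T s).continuous.tendsto g).comp h
  refine h'.congr fun t => ?_
  simp only [Function.comp, map_smul, map_sub]
  rw [← hT.add_apply, ← hT.add_apply, add_comm]

theorem tendsto_toNNReal_sub (s : ℝ) :
    Tendsto (fun r : ℝ => (r - s).toNNReal) (𝓝[>] s) (𝓝[>] 0) := by
  refine tendsto_nhdsWithin_iff.2 ⟨?_, ?_⟩
  · have : Continuous fun r : ℝ => (r - s).toNNReal := by fun_prop
    have h0 := this.tendsto s
    rw [sub_self, Real.toNNReal_zero] at h0
    exact h0.mono_left nhdsWithin_le_nhds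
  · filter_upwards [self_mem_nhdsWithin] with r hr
    simpa using hr

theorem tendsto_coe_nhdsGT_zero : Tendsto (fun t : ℝ≥0 => (t : ℝ)) (𝓝[>] 0) (𝓝[≠] 0) := by
  refine tendsto_nhdsWithin_iff.2 ⟨?_, ?_⟩
  · exact (NNReal.continuous_coe.tendsto 0).mono_left nhdsWithin_le_nhds
  · filter_upwards [self_mem_nhdsWithin] with r hr
    simpa using (ne_of_gt hr)

theorem toNNReal_eq_add {s r : ℝ} (hs : 0 ≤ s) (hr : s ≤ r) :
    r.toNNReal = (r - s).toNNReal + s.toNNReal := by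
  rw [← Real.toNNReal_add (sub_nonneg.2 hr) hs, sub_add_cancel]

theorem IsMarkovSemigroup.hasDerivWithinAt (hT : IsMarkovSemigroup T) {f g : C(Config S, ℝ)}
    (h : (f, g) ∈ generatorGraph T) {s : ℝ} (hs : 0 ≤ s) :
    HasDerivWithinAt (fun r : ℝ => T r.toNNReal f) (T s.toNNReal g) (Set.Ici s) s := by
  rw [← hasDerivWithinAt_Ioi_iff_Ici, hasDerivWithinAt_iff_tendsto_slope' (by simp)]
  refine ((hT.apply_mem_generatorGraph h s.toNNReal).comp (tendsto_toNNReal_sub s)).congr' ?_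
  filter_upwards [self_mem_nhdsWithin] with r hr
  have hr' : s ≤ r := le_of_lt hr
  simp only [Function.comp, slope, vsub_eq_sub, ← hT.add_apply]
  rw [← toNNReal_eq_add hs hr', Real.coe_toNNReal _ (sub_nonneg.2 hr')]

/-- A pair satisfying the integrated Kolmogorov equation belongs to the generator. -/
theorem IsMarkovSemigroup.mem_generatorGraph (hT : IsMarkovSemigroup T) {f g : C(Config S, ℝ)}
    (h : ∀ t : ℝ≥0, T t f - f = ∫ s in (0 : ℝ)..t, T s.toNNReal g) :
    (f, g) ∈ generatorGraph T := by
  have hc : Continuous fun s : ℝ => T s.toNNReal g :=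
    hT.continuous_apply continuous_real_toNNReal continuous_const
  have hd := intervalIntegral.integral_hasDerivAt_right (hc.intervalIntegrable 0 0)
    hc.aestronglyMeasurable.stronglyMeasurableAtFilter hc.continuousAt
  rw [hasDerivAt_iff_tendsto_slope_zero] at hd
  have := hd.comp tendsto_coe_nhdsGT_zero
  simp only [Real.toNNReal_zero, hT.zero] at this
  refine this.congr fun t => ?_
  simp [h t]

/-- A Markov semigroup is determined by its generator. -/
theorem IsMarkovSemigroup.ext_of_generatorGraph_eq (hT : IsMarkovSemigroup T)
    (hT' : IsMarkovSemigroup T') (hgen : generatorGraph T = generatorGraph T')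
    {D : Set C(Config S, ℝ)} (hD : Dense D) (hDgen : ∀ f ∈ D, ∃ g, (f, g) ∈ generatorGraph T) :
    T = T' := by
  have key : ∀ (t : ℝ≥0) (f g : C(Config S, ℝ)), (f, g) ∈ generatorGraph T → T t f = T' t f := by
    intro t f g hfg
    -- `s ↦ T'(t - s) T(s) f` interpolates between the two sides and has right derivative zero
    set φ : ℝ → C(Config S, ℝ) := fun s => T' ((t : ℝ) - s).toNNReal (T s.toNNReal f) with hφ
    have hcont : Continuous φ := hT'.continuous_apply (by fun_prop)
      (hT.continuous_apply continuous_real_toNNReal continuous_const)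
    have hder : ∀ s ∈ Set.Ico (0 : ℝ) t, HasDerivWithinAt φ 0 (Set.Ici s) s := by
      intro s hs
      have hu := hT.apply_mem_generatorGraph hfg s.toNNReal
      have hu' := hu
      rw [hgen] at hu'
      set u := T s.toNNReal f with hu_def
      have hlim := ((hu.comp (tendsto_toNNReal_sub s)).sub
        (hu'.comp (tendsto_toNNReal_sub s))).norm
      simp only [sub_self, norm_zero] at hlim
      rw [← hasDerivWithinAt_Ioi_iff_Ici, hasDerivWithinAt_iff_tendsto_slope' (by simp)]
      refine squeeze_zero_norm' ?_ hlim
      filter_upwards [Ioo_mem_nhdsGT hs.2] with r hr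
      have hr1 : s ≤ r := hr.1.le
      have e1 : φ r = T' ((t : ℝ) - r).toNNReal (T (r - s).toNNReal u) := by
        simp only [hφ]
        rw [toNNReal_eq_add hs.1 hr1, hT.add_apply]
      have e2 : φ s = T' ((t : ℝ) - r).toNNReal (T' (r - s).toNNReal u) := by
        simp only [hφ]
        rw [← hT'.add_apply, ← Real.toNNReal_add (by linarith [hr.2]) (by linarith)]
        congr 2
        ring_nf
      rw [slope, vsub_eq_sub, e1, e2, ← map_sub, ← map_smul]
      refine (hT'.norm_apply_le _ _).trans (le_of_eq ?_)
      simp only [Function.comp]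
      rw [← smul_sub, Real.coe_toNNReal _ (sub_nonneg.2 hr1), sub_sub_sub_cancel_right]
    have h := constant_of_has_deriv_right_zero hcont.continuousOn hder t ⟨t.2, le_rfl⟩
    simpa [hφ, hT.zero, hT'.zero] using h
  funext t
  refine ContinuousLinearMap.ext fun f => ?_
  refine congrFun (Continuous.ext_on hD (T t).continuous (T' t).continuous fun f hf => ?_) f
  obtain ⟨g, hg⟩ := hDgen f hf
  exact key t f g hg

end MarkovSemigroup

/-! ### The infinite volume limit -/

section InfiniteVolume

variable {S : Type*} [DecidableEq S] {P : S → S → ℝ} {f g : C(Config S, ℝ)}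

theorem mem_pregeneratorGraph_iff : (f, g) ∈ pregeneratorGraph P ↔
    IsCylinder f ∧ ∀ η, HasSum (fun e => jumpOp P e f η) (g η) := by
  simp only [← jumpTerm_eq]
  exact Iff.rfl

theorem IsCylinder.summable_jumpOp (hP : IsDoublySubstochastic P) (hf : IsCylinder f) :
    Summable fun e => jumpOp P e f := by
  obtain ⟨h, hh, K, hK, hfK⟩ := hf.exists_hasOscillation hP
  exact .of_norm_bounded (hh.summable.mul_left K) (hfK.norm_jumpOp_le hP.nonneg hh hK)

theorem IsCylinder.mem_pregeneratorGraph (hP : IsDoublySubstochastic P) (hf : IsCylinder f) :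
    (f, ∑' e, jumpOp P e f) ∈ pregeneratorGraph P := by
  exact mem_pregeneratorGraph_iff.2
    ⟨hf, fun η => ContinuousMap.hasSum_apply (hf.summable_jumpOp hP).hasSum η⟩

theorem hasSum_jumpOp (hP : IsDoublySubstochastic P) (hfg : (f, g) ∈ pregeneratorGraph P) :
    HasSum (fun e => jumpOp P e f) g := by
  have hf : IsCylinder f := hfg.1
  have h : g = ∑' e, jumpOp P e f := by
    ext η
    exact (hfg.2 η).unique ((hf.mem_pregeneratorGraph hP).2 η)
  rw [h]
  exact (hf.summable_jumpOp hP).hasSum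

theorem tendsto_volumeOp (hP : IsDoublySubstochastic P) (hfg : (f, g) ∈ pregeneratorGraph P) :
    Tendsto (fun F => volumeOp P F f) atTop (𝓝 g) := by
  simp only [volumeOp_apply]
  exact hasSum_jumpOp hP hfg

/-- On functions with small weighted oscillation, the generators of two large volumes nearly
agree. -/
theorem norm_volumeOp_sub_le (hP : ∀ x y, 0 ≤ P x y) {h : S → ℝ} {K : ℝ} (hh : IsWeight P h)
    (hK : 0 ≤ K) (hf : HasOscillation h K f) {F G : Finset (S × S)} (hFG : F ⊆ G) :
    ‖volumeOp P G f - volumeOp P F f‖ ≤ K * ∑ e ∈ G \ F, P e.1 e.2 * (h e.1 + h e.2) := by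
  rw [volumeOp_apply, volumeOp_apply, ← Finset.sum_sdiff hFG, add_sub_cancel_right, Finset.mul_sum]
  exact (norm_sum_le _ _).trans (Finset.sum_le_sum fun e _ => hf.norm_jumpOp_le hP hh hK e)

theorem exists_volume_sum_lt {h : S → ℝ} (hh : IsWeight P h) {ε : ℝ} (hε : 0 < ε) :
    ∃ F : Finset (S × S), ∀ G, ∑ e ∈ G \ F, P e.1 e.2 * (h e.1 + h e.2) < ε := by
  obtain ⟨F, hF⟩ := summable_iff_vanishing_norm.1 hh.summable ε hε
  exact ⟨F, fun G => (le_abs_self _).trans_lt (hF _ Finset.sdiff_disjoint)⟩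

theorem IsCylinder.cauchySeq_expFlow (hP : IsDoublySubstochastic P) (hf : IsCylinder f) {t : ℝ}
    (ht : 0 ≤ t) : CauchySeq fun F => expFlow (volumeOp P F) t f := by
  obtain ⟨h, hh, K, hK, hfK⟩ := hf.exists_hasOscillation hP
  refine Metric.cauchySeq_iff'.2 fun ε hε => ?_
  set M := Real.exp (4 * t) * K * t with hM
  have hM0 : 0 ≤ M := by positivity
  obtain ⟨F, hF⟩ := exists_volume_sum_lt hh (ε := ε / (M + 1)) (by positivity)
  refine ⟨F, fun G hFG => ?_⟩
  rw [dist_eq_norm]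
  have hb := norm_expFlow_sub_le (A := volumeOp P G) (B := volumeOp P F) (f := f)
    (C := Real.exp (4 * t) * K * (ε / (M + 1)))
    (fun t ht f => norm_expFlow_volumeOp_le hP.nonneg F ht f) ht fun s hs hst => by
      refine (norm_volumeOp_sub_le hP.nonneg hh (by positivity)
        (hfK.expFlow_volumeOp hP.nonneg hh hK G hs) hFG).trans ?_
      exact mul_le_mul (by gcongr) (hF G).le (Finset.sum_nonneg fun e _ =>
        mul_nonneg (hP.nonneg _ _) (add_nonneg (hh.nonneg _) (hh.nonneg _))) (by positivity)
  calc _ ≤ M * (ε / (M + 1)) := hb.trans (le_of_eq (by rw [hM]; ring))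
    _ < (M + 1) * (ε / (M + 1)) := by gcongr; linarith
    _ = ε := by field_simp

theorem cauchySeq_expFlow (hP : IsDoublySubstochastic P) {t : ℝ} (ht : 0 ≤ t)
    (f : C(Config S, ℝ)) : CauchySeq fun F => expFlow (volumeOp P F) t f := by
  refine Metric.cauchySeq_iff'.2 fun ε hε => ?_
  obtain ⟨f', hf', hff'⟩ := Metric.dense_iff.1 (dense_isCylinder S) f (ε / 3) (by positivity)
  have hd : ∀ F, ‖expFlow (volumeOp P F) t f - expFlow (volumeOp P F) t f'‖ < ε / 3 := fun F => by
    rw [← map_sub]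
    refine (norm_expFlow_volumeOp_le hP.nonneg F ht _).trans_lt ?_
    rwa [← dist_eq_norm, dist_comm]
  obtain ⟨F, hF⟩ := Metric.cauchySeq_iff'.1
    (IsCylinder.cauchySeq_expFlow hP hff' ht) (ε / 3) (by positivity)
  refine ⟨F, fun G hG => ?_⟩
  have h1 := hd G
  have h2 := hd F
  have h3 := hF G hG
  rw [dist_eq_norm] at h3 ⊢
  calc _ = ‖(expFlow (volumeOp P G) t f - expFlow (volumeOp P G) t f') +
        (expFlow (volumeOp P G) t f' - expFlow (volumeOp P F) t f') -
        (expFlow (volumeOp P F) t f - expFlow (volumeOp P F) t f')‖ := by congr 1; abel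
    _ ≤ _ := (norm_sub_le _ _).trans (add_le_add_left (norm_add_le _ _) _)
    _ < ε := by linarith

/-- The finite volume semigroups converge strongly. -/
theorem exists_tendsto_expFlow [Countable S] (hP : IsDoublySubstochastic P) :
    ∃ T : OperatorFamily S, ∀ (t : ℝ≥0) (f : C(Config S, ℝ)),
      Tendsto (fun F => expFlow (volumeOp P F) t f) atTop (𝓝 (T t f)) := by
  have h : ∀ (t : ℝ≥0), ∃ L : C(Config S, ℝ) →L[ℝ] C(Config S, ℝ), ∀ f,
      Tendsto (fun F => expFlow (volumeOp P F) t f) atTop (𝓝 (L f)) := by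
    intro t
    choose L hL using fun f => cauchySeq_tendsto_of_complete (cauchySeq_expFlow hP t.2 f)
    exact ⟨continuousLinearMapOfTendsto (fun F => expFlow (volumeOp P F) t)
      (tendsto_pi_nhds.2 hL), hL⟩
  choose T hT using h
  exact ⟨T, hT⟩

theorem IsExclusionSemigroup.mem_generatorGraph {T : OperatorFamily S}
    (hT : IsExclusionSemigroup P T)
    (hfg : (f, g) ∈ pregeneratorGraph P) : (f, g) ∈ generatorGraph T := by
  rw [hT.generator_eq]
  exact subset_closure hfg

section Limit

variable {T : OperatorFamily S} (hP : IsDoublySubstochastic P)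
  (hT : ∀ (t : ℝ≥0) (f : C(Config S, ℝ)),
      Tendsto (fun F => expFlow (volumeOp P F) t f) atTop (𝓝 (T t f)))
include hP hT

theorem norm_limit_apply_le (t : ℝ≥0) (f : C(Config S, ℝ)) : ‖T t f‖ ≤ ‖f‖ :=
  le_of_tendsto (hT t f).norm
    (Eventually.of_forall fun F => norm_expFlow_volumeOp_le hP.nonneg F t.2 f)

theorem tendsto_expFlow_apply (t : ℝ≥0) {u : Finset (S × S) → C(Config S, ℝ)}
    (hu : Tendsto u atTop (𝓝 f)) :
    Tendsto (fun F => expFlow (volumeOp P F) t (u F)) atTop (𝓝 (T t f)) := by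
  have h2 : Tendsto (fun F => expFlow (volumeOp P F) t (u F - f)) atTop (𝓝 0) := by
    refine squeeze_zero_norm (fun F => norm_expFlow_volumeOp_le hP.nonneg F t.2 _) ?_
    simpa using (hu.sub_const f).norm
  simpa using h2.add (hT t f)

theorem limit_add_apply (s t : ℝ≥0) (f : C(Config S, ℝ)) : T (s + t) f = T s (T t f) := by
  refine tendsto_nhds_unique (hT (s + t) f) ?_
  refine (tendsto_expFlow_apply hP hT s (hT t f)).congr fun F => ?_
  rw [NNReal.coe_add, expFlow_add]

theorem norm_limit_sub_le (hf : IsCylinder f) :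
    ∃ C : ℝ, 0 ≤ C ∧ ∀ t : ℝ≥0, ‖T t f - f‖ ≤ C * t := by
  obtain ⟨g, hfg⟩ : ∃ g, (f, g) ∈ pregeneratorGraph P := ⟨_, hf.mem_pregeneratorGraph hP⟩
  refine ⟨‖g‖, norm_nonneg _, fun t => ?_⟩
  refine le_of_tendsto_of_tendsto ((hT t f).sub_const f).norm
    ((tendsto_volumeOp hP hfg).norm.mul_const (t : ℝ)) (Eventually.of_forall fun F => ?_)
  have h0 : ∀ (s : ℝ) (u : C(Config S, ℝ)),
      expFlow (0 : C(Config S, ℝ) →L[ℝ] C(Config S, ℝ)) s u = u :=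
    fun s u => expFlow_apply_of_map_eq_zero rfl s
  have h := norm_expFlow_sub_le (A := volumeOp P F) (B := 0) (f := f) (C := ‖volumeOp P F f‖)
    (fun s _ u => by rw [h0]) t.2 fun s hs _ => by
      rw [← expFlow_apply_comm]
      simpa using norm_expFlow_volumeOp_le hP.nonneg F hs _
  rwa [h0] at h

theorem isMarkovSemigroup_limit : IsMarkovSemigroup T where
  zero := by
    ext1 f
    refine tendsto_nhds_unique (hT 0 f) ?_
    simp only [NNReal.coe_zero, expFlow_zero]
    exact tendsto_const_nhds
  add s t := by
    ext1 f
    exact limit_add_apply hP hT s t f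
  continuous f := by
    refine continuous_of_uniform_approx_of_continuous fun u hu => ?_
    obtain ⟨ε, hε, hεu⟩ := Metric.mem_uniformity_dist.1 hu
    obtain ⟨f', hff', hf'⟩ := Metric.dense_iff.1 (dense_isCylinder S) f ε hε
    obtain ⟨C, hC0, hC⟩ := norm_limit_sub_le hP hT hf'
    refine ⟨fun t => T t f', ?_, fun t => hεu ?_⟩
    · refine (LipschitzWith.of_dist_le_mul (K := C.toNNReal) fun s t => ?_).continuous
      wlog hst : s ≤ t generalizing s t
      · rw [dist_comm, dist_comm s]
        exact this t s (le_of_not_ge hst)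
      obtain ⟨r, rfl⟩ := exists_add_of_le hst
      rw [dist_comm, dist_eq_norm, limit_add_apply hP hT, ← map_sub, Real.coe_toNNReal _ hC0]
      refine (norm_limit_apply_le hP hT _ _).trans ((hC r).trans (le_of_eq ?_))
      rw [NNReal.dist_eq]
      simp
    · rw [dist_eq_norm, ← map_sub]
      refine (norm_limit_apply_le hP hT _ _).trans_lt ?_
      rwa [← dist_eq_norm, dist_comm]
  one t := by
    refine tendsto_nhds_unique (hT t 1) ?_
    simp only [expFlow_volumeOp_one]
    exact tendsto_const_nhds
  nonneg t f hf := by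
    refine nonneg_of_norm_apply_le (norm_limit_apply_le hP hT t) ?_ hf
    refine tendsto_nhds_unique (hT t 1) ?_
    simp only [expFlow_volumeOp_one]
    exact tendsto_const_nhds

theorem limit_sub_eq_integral [Countable S] (hfg : (f, g) ∈ pregeneratorGraph P) (t : ℝ≥0) :
    T t f - f = ∫ s in (0 : ℝ)..t, T s.toNNReal g := by
  have h1 : Tendsto (fun F => ∫ s in (0 : ℝ)..t, expFlow (volumeOp P F) s (volumeOp P F f))
      atTop (𝓝 (T t f - f)) := by
    simp only [integral_expFlow]
    exact (hT t f).sub_const f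
  refine tendsto_nhds_unique h1 ?_
  have hlim := tendsto_volumeOp hP hfg
  have hsub : ∀ s ∈ Set.uIoc (0 : ℝ) t, 0 ≤ s := fun s hs => by
    rw [Set.uIoc_of_le t.coe_nonneg] at hs
    exact hs.1.le
  refine intervalIntegral.tendsto_integral_filter_of_dominated_convergence
    (fun _ => ‖g‖ + 1) ?_ ?_ intervalIntegrable_const ?_
  · exact Eventually.of_forall fun F => (continuous_expFlow _ _).aestronglyMeasurable
  · have hle : ∀ᶠ F in atTop, ‖volumeOp P F f‖ ≤ ‖g‖ + 1 :=
      (hlim.norm.eventually_lt_const (lt_add_one _)).mono fun F hF => hF.le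
    filter_upwards [hle] with F hF
    exact Eventually.of_forall fun s hs =>
      (norm_expFlow_volumeOp_le hP.nonneg F (hsub s hs) _).trans hF
  · refine Eventually.of_forall fun s hs => ?_
    have := tendsto_expFlow_apply hP hT s.toNNReal hlim
    rwa [Real.coe_toNNReal _ (hsub s hs)] at this

/-- The integrated Kolmogorov equation passes to the closure, so that the generator extends the
closure of the pregenerator. -/
theorem closure_subset_generatorGraph [Countable S] : closure (pregeneratorGraph P) ⊆ generatorGraph T := by
  have hM := isMarkovSemigroup_limit hP hT
  intro fg hfg
  refine hM.mem_generatorGraph fun t => ?_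
  have hclosed : IsClosed {u : C(Config S, ℝ) × C(Config S, ℝ) |
      T t u.1 - u.1 = ∫ s in (0 : ℝ)..t, T s.toNNReal u.2} := by
    refine isClosed_eq (by fun_prop) ?_
    refine intervalIntegral.continuous_parametric_intervalIntegral_of_continuous' ?_ 0 t
    exact hM.continuous_apply (by fun_prop) (by fun_prop)
  exact closure_minimal (fun u hu => limit_sub_eq_integral hP hT hu t) hclosed hfg

/-- The semigroup maps the domain of the pregenerator into the domain of its closure. -/
theorem limit_apply_mem_closure (hfg : (f, g) ∈ pregeneratorGraph P) (t : ℝ≥0) :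
    (T t f, T t g) ∈ closure (pregeneratorGraph P) := by
  have hf : IsCylinder f := hfg.1
  obtain ⟨h, hh, K, hK, hfK⟩ := hf.exists_hasOscillation hP
  set u : Finset (S × S) → C(Config S, ℝ) := fun F => expFlow (volumeOp P F) t f with hu
  have hcyl : ∀ F, IsCylinder (u F) := fun F => isCylinder_expFlow_volumeOp P F t hf
  have hmem : ∀ F, (u F, ∑' e, jumpOp P e (u F)) ∈ pregeneratorGraph P := fun F =>
    (hcyl F).mem_pregeneratorGraph hP
  set K' := Real.exp (4 * t) * K with hK'
  have hK'0 : 0 ≤ K' := by positivity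
  refine mem_closure_of_tendsto (b := atTop) (f := fun F => (u F, ∑' e, jumpOp P e (u F)))
    ((hT t f).prodMk_nhds ?_) (Eventually.of_forall hmem)
  have h1 : Tendsto (fun F => volumeOp P F (u F)) atTop (𝓝 (T t g)) := by
    simp only [hu, ← expFlow_apply_comm]
    exact tendsto_expFlow_apply hP hT t (tendsto_volumeOp hP hfg)
  have h2 : Tendsto (fun F => ∑' e, jumpOp P e (u F) - volumeOp P F (u F)) atTop (𝓝 0) := by
    refine Metric.tendsto_atTop.2 fun ε hε => ?_
    obtain ⟨F₀, hF₀⟩ := exists_volume_sum_lt hh (ε := ε / 2 / (K' + 1)) (by positivity)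
    refine ⟨F₀, fun F hF => ?_⟩
    rw [dist_zero_right]
    refine lt_of_le_of_lt (b := ε / 2) ?_ (half_lt_self hε)
    refine le_of_tendsto (((tendsto_volumeOp hP (hmem F)).sub_const _).norm) ?_
    filter_upwards [eventually_ge_atTop F] with G hG
    refine (norm_volumeOp_sub_le hP.nonneg hh hK'0
      (hfK.expFlow_volumeOp hP.nonneg hh hK F t.2) hG).trans ?_
    have hle : ∑ e ∈ G \ F, P e.1 e.2 * (h e.1 + h e.2) ≤
        ∑ e ∈ G \ F₀, P e.1 e.2 * (h e.1 + h e.2) :=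
      Finset.sum_le_sum_of_subset_of_nonneg (Finset.sdiff_subset_sdiff subset_rfl hF)
        fun e _ _ => mul_nonneg (hP.nonneg _ _) (add_nonneg (hh.nonneg _) (hh.nonneg _))
    calc _ ≤ K' * (ε / 2 / (K' + 1)) := by gcongr; exact hle.trans (hF₀ G).le
      _ ≤ (K' + 1) * (ε / 2 / (K' + 1)) := by gcongr; linarith
      _ = ε / 2 := by field_simp
  simpa using h2.add h1

end Limit

/-- The pregenerator as a linear subspace of `C(X) × C(X)`. -/
def pregeneratorSubmodule (P : S → S → ℝ) : Submodule ℝ (C(Config S, ℝ) × C(Config S, ℝ)) where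
  carrier := pregeneratorGraph P
  add_mem' := by
    rintro ⟨f, f'⟩ ⟨g, g'⟩ hf hg
    rw [mem_pregeneratorGraph_iff] at hf hg
    refine mem_pregeneratorGraph_iff.2 ⟨(cylinderAlgebra S).add_mem hf.1 hg.1, fun η => ?_⟩
    simpa using (hf.2 η).add (hg.2 η)
  zero_mem' := by
    refine mem_pregeneratorGraph_iff.2 ⟨(cylinderAlgebra S).zero_mem, fun η => ?_⟩
    simp
  smul_mem' := by
    rintro c ⟨f, f'⟩ hf
    rw [mem_pregeneratorGraph_iff] at hf
    refine mem_pregeneratorGraph_iff.2 ⟨(cylinderAlgebra S).smul_mem hf.1 c, fun η => ?_⟩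
    simpa using (hf.2 η).mul_left c

theorem integral_mem_of_isClosed {E : Type*} [NormedAddCommGroup E] [NormedSpace ℝ E]
    [CompleteSpace E] {V : Submodule ℝ E} (hV : IsClosed (V : Set E)) {u : ℝ → E}
    (hu : Continuous u) {a b : ℝ} (hab : a ≤ b) (h : ∀ s ∈ Set.Icc a b, u s ∈ V) :
    ∫ s in a..b, u s ∈ V := by
  -- closedness of `V` makes the quotient a normed space, in which the integrand vanishes
  have : IsClosed (V : Set E) := hV
  rw [← Submodule.Quotient.mk_eq_zero, ← Submodule.mkQ_apply]
  change V.mkQL _ = 0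
  rw [← ContinuousLinearMap.intervalIntegral_comp_comm _ (hu.intervalIntegrable a b)]
  refine (intervalIntegral.integral_congr (g := fun _ => 0) fun s hs => ?_).trans
    intervalIntegral.integral_zero
  rw [Set.uIcc_of_le hab] at hs
  exact (Submodule.Quotient.mk_eq_zero V).2 (h s hs)

variable [Countable S]

/-- The pairs `(∫₀ᵗ T(s) f ds, T(t) f - f)` belong to the closure of the pregenerator. -/
theorem integral_mem_closure (hP : IsDoublySubstochastic P) {T : OperatorFamily S}
    (hT : ∀ (t : ℝ≥0) (f : C(Config S, ℝ)),
      Tendsto (fun F => expFlow (volumeOp P F) t f) atTop (𝓝 (T t f)))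
    (f : C(Config S, ℝ)) (t : ℝ≥0) :
    (∫ s in (0 : ℝ)..t, T s.toNNReal f, T t f - f) ∈ closure (pregeneratorGraph P) := by
  have hM := isMarkovSemigroup_limit hP hT
  have hc : Continuous fun f : C(Config S, ℝ) => (∫ s in (0 : ℝ)..t, T s.toNNReal f, T t f - f) := by
    refine Continuous.prodMk ?_ (by fun_prop)
    refine intervalIntegral.continuous_parametric_intervalIntegral_of_continuous' ?_ 0 t
    exact hM.continuous_apply (by fun_prop) (by fun_prop)
  have hclosed := (isClosed_closure (s := pregeneratorGraph P)).preimage hc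
  have hsub : {f : C(Config S, ℝ) | IsCylinder f} ⊆
      (fun f : C(Config S, ℝ) => (∫ s in (0 : ℝ)..t, T s.toNNReal f, T t f - f)) ⁻¹'
        closure (pregeneratorGraph P) := by
    intro f hf
    have hfg := IsCylinder.mem_pregeneratorGraph hP hf
    set g := ∑' e, jumpOp P e f
    have hcf : Continuous fun s : ℝ => T s.toNNReal f :=
      hM.continuous_apply (by fun_prop) continuous_const
    have hcg : Continuous fun s : ℝ => T s.toNNReal g :=
      hM.continuous_apply (by fun_prop) continuous_const
    have h := integral_mem_of_isClosed (pregeneratorSubmodule P).isClosed_topologicalClosure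
      (hcf.prodMk hcg) t.2 fun s _ => limit_apply_mem_closure hP hT hfg s.toNNReal
    have hi := (hcf.prodMk hcg).intervalIntegrable (μ := volume) 0 t
    have e1 := (ContinuousLinearMap.fst ℝ _ _).intervalIntegral_comp_comm hi
    have e2 := (ContinuousLinearMap.snd ℝ _ _).intervalIntegral_comp_comm hi
    change (_, _) ∈ closure _
    rw [limit_sub_eq_integral hP hT hfg t]
    have e3 : (∫ s in (0 : ℝ)..t, T s.toNNReal f, ∫ s in (0 : ℝ)..t, T s.toNNReal g) =
        ∫ s in (0 : ℝ)..t, (T s.toNNReal f, T s.toNNReal g) := Prod.ext e1 e2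
    rw [e3]
    exact h
  exact closure_minimal hsub hclosed ((dense_isCylinder S) f)

theorem generatorGraph_subset_closure (hP : IsDoublySubstochastic P) {T : OperatorFamily S}
    (hT : ∀ (t : ℝ≥0) (f : C(Config S, ℝ)),
      Tendsto (fun F => expFlow (volumeOp P F) t f) atTop (𝓝 (T t f))) :
    generatorGraph T ⊆ closure (pregeneratorGraph P) := by
  rintro ⟨f, g⟩ hfg
  have hM := isMarkovSemigroup_limit hP hT
  have hc : Continuous fun s : ℝ => T s.toNNReal f :=
    hM.continuous_apply (by fun_prop) continuous_const
  have hd := intervalIntegral.integral_hasDerivAt_right (hc.intervalIntegrable 0 0)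
    hc.aestronglyMeasurable.stronglyMeasurableAtFilter hc.continuousAt
  rw [hasDerivAt_iff_tendsto_slope_zero] at hd
  have h1 := hd.comp tendsto_coe_nhdsGT_zero
  simp only [Real.toNNReal_zero, hM.zero] at h1
  rw [← isClosed_closure.closure_eq]
  refine mem_closure_of_tendsto (h1.prodMk_nhds hfg) (Eventually.of_forall fun t => ?_)
  have h2 := (pregeneratorSubmodule P).topologicalClosure.smul_mem (t : ℝ)⁻¹
    (integral_mem_closure hP hT f t)
  simp only [Function.comp, zero_add, intervalIntegral.integral_same, sub_zero]
  exact h2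

/-- **Existence and uniqueness of the exclusion process** with doubly substochastic rates. -/
theorem existsUnique_isExclusionSemigroup (hP : IsDoublySubstochastic P) :
    ∃! T : OperatorFamily S, IsExclusionSemigroup P T := by
  obtain ⟨T, hT⟩ := exists_tendsto_expFlow hP
  have hM := isMarkovSemigroup_limit hP hT
  have hgen : generatorGraph T = closure (pregeneratorGraph P) :=
    (generatorGraph_subset_closure hP hT).antisymm (closure_subset_generatorGraph hP hT)
  refine ⟨T, ⟨hM, hgen⟩, fun T' hT' => ?_⟩
  refine hT'.toIsMarkovSemigroup.ext_of_generatorGraph_eq hM (hT'.generator_eq.trans hgen.symm)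
    (dense_isCylinder S) fun f hf => ⟨∑' e, jumpOp P e f, ?_⟩
  rw [hT'.generator_eq]
  exact subset_closure (IsCylinder.mem_pregeneratorGraph hP hf)

end InfiniteVolume

/-! ### Infinitesimal criteria for stationarity and reversibility -/

section Infinitesimal

variable {S : Type*} [Countable S] {μ : Measure (Config S)} [IsProbabilityMeasure μ]

theorem integrable_config (f : C(Config S, ℝ)) : Integrable f μ :=
  Integrable.of_bound f.continuous.aestronglyMeasurable ‖f‖
    (Eventually.of_forall fun η => f.norm_coe_le_norm η)

variable (μ) in
/-- Integration against a probability measure, as a continuous linear functional. -/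
def integralFunctional : C(Config S, ℝ) →L[ℝ] ℝ :=
  LinearMap.mkContinuous
    { toFun := fun f => ∫ η, f η ∂μ
      map_add' := fun f g => integral_add (integrable_config f) (integrable_config g)
      map_smul' := fun c f => integral_const_mul c f } 1 fun f => by
    refine (norm_integral_le_of_norm_le_const (C := ‖f‖)
      (Eventually.of_forall fun η => f.norm_coe_le_norm η)).trans ?_
    simp

@[simp] theorem integralFunctional_apply (f : C(Config S, ℝ)) :
    integralFunctional μ f = ∫ η, f η ∂μ := rfl

variable [DecidableEq S] {P : S → S → ℝ} {T : OperatorFamily S} {f g : C(Config S, ℝ)}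

theorem IsExclusionSemigroup.isStationary_iff (hP : IsDoublySubstochastic P)
    (hT : IsExclusionSemigroup P T) :
    IsStationary T μ ↔ ∀ fg ∈ pregeneratorGraph P, ∫ η, fg.2 η ∂μ = 0 := by
  have hM := hT.toIsMarkovSemigroup
  constructor
  · rintro h ⟨f, g⟩ hfg
    have h1 := ((integralFunctional μ).continuous.tendsto g).comp (hT.mem_generatorGraph hfg)
    refine tendsto_nhds_unique h1 (tendsto_const_nhds.congr fun t => ?_)
    simp only [Function.comp, map_smul, map_sub, integralFunctional_apply, h t f, sub_self,
      smul_zero]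
  · intro h
    have hgen : ∀ fg ∈ generatorGraph T, integralFunctional μ fg.2 = 0 := by
      rw [hT.generator_eq]
      exact fun fg hfg => closure_minimal
        (t := {fg : C(Config S, ℝ) × C(Config S, ℝ) | integralFunctional μ fg.2 = 0})
        (fun u hu => h u hu) (isClosed_eq (by fun_prop) continuous_const) hfg
    have key : ∀ (t : ℝ≥0) (f g : C(Config S, ℝ)), (f, g) ∈ generatorGraph T →
        integralFunctional μ (T t f) = integralFunctional μ f := by
      intro t f g hfg
      have hc : Continuous fun s : ℝ => integralFunctional μ (T s.toNNReal f) :=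
        (integralFunctional μ).continuous.comp
          (hM.continuous_apply continuous_real_toNNReal continuous_const)
      have hd : ∀ s ∈ Set.Ico (0 : ℝ) t,
          HasDerivWithinAt (fun s : ℝ => integralFunctional μ (T s.toNNReal f)) 0 (Set.Ici s) s := by
        intro s hs
        have := (integralFunctional μ).hasFDerivAt.comp_hasDerivWithinAt s
          (hM.hasDerivWithinAt hfg hs.1)
        rwa [hgen _ (hM.apply_mem_generatorGraph hfg s.toNNReal)] at this
      simpa [hM.zero] using constant_of_has_deriv_right_zero hc.continuousOn hd t ⟨t.2, le_rfl⟩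
    intro t f
    refine congrFun (Continuous.ext_on (dense_isCylinder S)
      ((integralFunctional μ).continuous.comp (T t).continuous)
      (integralFunctional μ).continuous fun f hf => ?_) f
    exact key t f _ (hT.mem_generatorGraph (IsCylinder.mem_pregeneratorGraph hP hf))

theorem hasSum_integral_jumpOp (hP : IsDoublySubstochastic P)
    (hfg : (f, g) ∈ pregeneratorGraph P) (k : C(Config S, ℝ)) :
    HasSum (fun e => ∫ η, k η * jumpOp P e f η ∂μ) (∫ η, k η * g η ∂μ) := by
  have h := (integralFunctional μ).hasSum ((hasSum_jumpOp hP hfg).mul_left k)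
  simpa using h

theorem IsReversible.integral_mul_eq {f' g' : C(Config S, ℝ)} (hT : IsExclusionSemigroup P T)
    (hrev : IsReversible T μ) (hf : (f, f') ∈ pregeneratorGraph P)
    (hg : (g, g') ∈ pregeneratorGraph P) : ∫ η, f η * g' η ∂μ = ∫ η, g η * f' η ∂μ := by
  have h1 : ∀ {f g g' : C(Config S, ℝ)}, (g, g') ∈ generatorGraph T →
      Tendsto (fun t : ℝ≥0 => (t : ℝ)⁻¹ * (∫ η, f η * T t g η ∂μ - ∫ η, f η * g η ∂μ)) (𝓝[>] 0)
        (𝓝 (∫ η, f η * g' η ∂μ)) := by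
    intro f g g' h
    have hc : Continuous fun u : C(Config S, ℝ) => integralFunctional μ (f * u) := by fun_prop
    refine ((hc.tendsto g').comp h).congr fun t => ?_
    simp only [Function.comp, mul_smul_comm, mul_sub, map_smul, map_sub, smul_eq_mul]
    rfl
  refine tendsto_nhds_unique (h1 (hT.mem_generatorGraph hg))
    ((h1 (hT.mem_generatorGraph hf)).congr fun t => ?_)
  rw [hrev t f g]
  simp only [mul_comm]

end Infinitesimal

/-! ### Product measures -/

section ProductMeasure

variable {S : Type*} {α : S → unitInterval}

instance (α : S → unitInterval) : IsProbabilityMeasure (productMeasure α) := by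
  unfold productMeasure; infer_instance

/-- The function `η ↦ φ (η x)` of a single coordinate. -/
def siteFun (x : S) (φ : Bool → ℝ) : C(Config S, ℝ) :=
  ⟨fun η => φ (η x), continuous_of_discreteTopology.comp (continuous_apply x)⟩

@[simp] theorem siteFun_apply (x : S) (φ : Bool → ℝ) (η : Config S) :
    siteFun x φ η = φ (η x) := rfl

theorem siteFun_mem_dependingOn {x : S} {A : Set S} (hx : x ∈ A) (φ : Bool → ℝ) :
    siteFun x φ ∈ dependingOn A := fun η ζ h => by simp [h x hx]

theorem mul_mem_dependingOn {A : Set S} {f g : C(Config S, ℝ)} (hf : f ∈ dependingOn A)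
    (hg : g ∈ dependingOn A) : f * g ∈ dependingOn A := fun η ζ h => by
  simp [hf h, hg h]

/-- The mean of `φ (η x)` under `ν_α`. -/
def siteMean (α : S → unitInterval) (x : S) (φ : Bool → ℝ) : ℝ :=
  α x * φ true + (1 - α x) * φ false

theorem integral_siteFun (x : S) (φ : Bool → ℝ) :
    ∫ η, siteFun x φ η ∂productMeasure α = siteMean α x φ := by
  have h := (measurePreserving_eval_infinitePi
    (fun x => ProbabilityTheory.bernoulliMeasure true false (α x)) x)
  have h2 := integral_map (μ := productMeasure α) (measurable_pi_apply x).aemeasurable (f := φ)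
    (continuous_of_discreteTopology (f := φ)).aestronglyMeasurable
  change ∫ η, φ (η x) ∂productMeasure α = _
  rw [← h2]
  change ∫ b, φ b ∂((productMeasure α).map (Function.eval x)) = _
  rw [productMeasure, h.map_eq, ProbabilityTheory.integral_bernoulliMeasure]
  simp [siteMean]

theorem IsCylinder.mem_dependingOn {f : C(Config S, ℝ)} (hf : IsCylinder f) :
    ∃ A : Finset S, f ∈ dependingOn (A : Set S) := hf

/-- The indicator of an occupied site, as a function of the coordinate. -/
def occ (b : Bool) : ℝ := if b = true then 1 else 0

/-- The indicator of a vacant site, as a function of the coordinate. -/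
def vac (b : Bool) : ℝ := if b = true then 0 else 1

/-- The centred occupation variable, as a function of the coordinate. -/
def centred (a : ℝ) (b : Bool) : ℝ := occ b - a

theorem siteMean_occ (x : S) : siteMean α x occ = α x := by simp [siteMean, occ]

theorem siteMean_vac (x : S) : siteMean α x vac = 1 - α x := by simp [siteMean, vac]

theorem siteMean_centred (x : S) : siteMean α x (centred (α x)) = 0 := by
  simp [siteMean, centred, occ]; ring

variable [Countable S]

/-- Under `ν_α`, a coordinate is independent of any function of finitely many other coordinates. -/
theorem integral_siteFun_mul {x : S} {A : Finset S} (hx : x ∉ A) (φ : Bool → ℝ)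
    {f : C(Config S, ℝ)} (hf : f ∈ dependingOn (A : Set S)) :
    ∫ η, φ (η x) * f η ∂productMeasure α = siteMean α x φ * ∫ η, f η ∂productMeasure α := by
  classical
  have hind := ProbabilityTheory.iIndepFun_infinitePi
    (P := fun x => ProbabilityTheory.bernoulliMeasure true false (α x))
    (X := fun _ b => b) (fun _ => measurable_id)
  have h2 := hind.indepFun_finset {x} A (by simpa using hx) (fun i => measurable_pi_apply i)
  obtain ⟨F, hF⟩ := (dependsOn_iff_exists_comp (f := f) (s := (A : Set S))).1 hf
  have h3 := h2.comp (φ := fun b : ({x} : Finset S) → Bool => φ (b ⟨x, by simp⟩))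
    (ψ := fun b : A → Bool => F b) (measurable_of_countable _) (measurable_of_countable _)
  have h4 : ProbabilityTheory.IndepFun (siteFun x φ) f (productMeasure α) := by
    rw [hF]
    exact h3
  have h5 := h4.integral_mul_eq_mul_integral
    (siteFun x φ).continuous.aestronglyMeasurable f.continuous.aestronglyMeasurable
  rwa [integral_siteFun] at h5

theorem integral_siteFun_mul_siteFun_mul [DecidableEq S] {x y : S} {A : Finset S} (hxy : x ≠ y)
    (hx : x ∉ A) (hy : y ∉ A) (φ ψ : Bool → ℝ) {f : C(Config S, ℝ)}
    (hf : f ∈ dependingOn (A : Set S)) :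
    ∫ η, φ (η x) * ψ (η y) * f η ∂productMeasure α =
      siteMean α x φ * siteMean α y ψ * ∫ η, f η ∂productMeasure α := by
  have h := integral_siteFun_mul (α := α) (x := x) (A := insert y A) (by simp [hxy, hx]) φ
    (f := siteFun y ψ * f) (mul_mem_dependingOn (siteFun_mem_dependingOn (by simp) ψ)
      (DependsOn.mono (by simp) hf))
  rw [mul_assoc, ← integral_siteFun_mul hy ψ hf]
  refine Eq.trans ?_ h
  simp only [ContinuousMap.mul_apply, siteFun_apply, mul_assoc]

/-- `∫ f 1{η x = 1, η y = 0} dν_α`. -/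
def pairMass (α : S → unitInterval) (f : C(Config S, ℝ)) (x y : S) : ℝ :=
  ∫ η, occ (η x) * vac (η y) * f η ∂productMeasure α

variable [DecidableEq S]

/-- The mean of the change of `f` in an attempted jump from `x` to `y`. On the event that the jump
takes place, `f` may be replaced by its value with `x` vacant and `y` occupied, which is independent
of the two sites; the odds ratio is the ratio of the masses of the configurations before and after
the jump. -/
theorem integral_move_sub (hα : ∀ x, 0 < α x ∧ α x < 1) {f : C(Config S, ℝ)} (hf : IsCylinder f)
    (x y : S) : ∫ η, (f (move (x, y) η) - f η) ∂productMeasure α =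
      odds α x / odds α y * pairMass α f y x - pairMass α f x y := by
  have hα0 : ∀ x, (α x : ℝ) ≠ 0 := fun x => by
    have : (0 : ℝ) < α x := (hα x).1
    exact this.ne'
  have hα1 : ∀ x, 1 - (α x : ℝ) ≠ 0 := fun x => by
    have : (α x : ℝ) < 1 := (hα x).2
    exact (sub_pos.2 this).ne'
  by_cases hxy : x = y
  · subst hxy
    have h1 : ∀ η : Config S, move (x, x) η = η := fun η => by
      unfold move
      cases η x <;> simp
    have h2 : pairMass α f x x = 0 := by
      rw [pairMass]
      refine integral_eq_zero_of_ae (Eventually.of_forall fun η => ?_)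
      cases h : η x <;> simp [h, occ, vac]
    simp [h1, h2]
  obtain ⟨A, hA⟩ := hf.mem_dependingOn
  set G : C(Config S, ℝ) := f.comp ⟨fun η => Function.update (Function.update η x false) y true,
    by fun_prop⟩ with hG
  have hGA : G ∈ dependingOn ((A \ {x, y} : Finset S) : Set S) := by
    intro η ζ h
    refine hA fun z hz => ?_
    change Function.update (Function.update η x false) y true z =
      Function.update (Function.update ζ x false) y true z
    by_cases hzy : z = y
    · simp [hzy]
    by_cases hzx : z = x
    · subst hzx; simp [hzy]
    · simpa [hzy, hzx] using h z (by simpa [hzy, hzx] using hz)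
  have hGval : ∀ η, G η = f (Function.update (Function.update η x false) y true) := fun η => rfl
  have hjump : ∀ η, f (move (x, y) η) - f η =
      occ (η x) * vac (η y) * G η - occ (η x) * vac (η y) * f η := by
    intro η
    by_cases h : η x = true ∧ η y = false
    · have : move (x, y) η = Function.update (Function.update η x false) y true := by
        funext z
        rw [move, if_pos h, exchange]
        by_cases hzy : z = y
        · subst hzy; simp [h.1]
        by_cases hzx : z = x
        · subst hzx; simp [hzy, h.2]
        · simp [hzy, hzx, Equiv.swap_apply_of_ne_of_ne hzx hzy]
      rw [this, hGval]
      simp [h.1, h.2, occ, vac]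
    · rw [move, if_neg h, sub_self]
      cases h1 : η x <;> cases h2 : η y <;> simp_all [occ, vac]
  have hrev : ∀ η, occ (η y) * vac (η x) * f η = occ (η y) * vac (η x) * G η := by
    intro η
    by_cases h : η y = true ∧ η x = false
    · have : Function.update (Function.update η x false) y true = η := by
        rw [← h.2, Function.update_eq_self, ← h.1, Function.update_eq_self]
      rw [hGval, this]
    · cases h1 : η x <;> cases h2 : η y <;> simp_all [occ, vac]
  have e1 : pairMass α G x y = α x * (1 - α y) * ∫ η, G η ∂productMeasure α := by
    rw [pairMass, integral_siteFun_mul_siteFun_mul hxy (by simp) (by simp) _ _ hGA, siteMean_occ,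
      siteMean_vac]
  have e2 : pairMass α f y x = α y * (1 - α x) * ∫ η, G η ∂productMeasure α := by
    rw [pairMass, integral_congr_ae (Eventually.of_forall hrev),
      integral_siteFun_mul_siteFun_mul (Ne.symm hxy) (by simp) (by simp) _ _ hGA, siteMean_occ,
      siteMean_vac]
  have hi : ∀ k : C(Config S, ℝ),
      Integrable (fun η => occ (η x) * vac (η y) * k η) (productMeasure α) := fun k =>
    integrable_config (siteFun x occ * siteFun y vac * k)
  rw [integral_congr_ae (Eventually.of_forall hjump), integral_sub (hi G) (hi f)]
  change pairMass α G x y - pairMass α f x y = _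
  rw [e1, e2, odds, odds]
  have := hα0 x; have := hα0 y; have := hα1 x; have := hα1 y
  field_simp

theorem integral_jumpOp (hα : ∀ x, 0 < α x ∧ α x < 1) (P : S → S → ℝ) {f : C(Config S, ℝ)}
    (hf : IsCylinder f) (e : S × S) : ∫ η, jumpOp P e f η ∂productMeasure α =
      P e.1 e.2 * (odds α e.1 / odds α e.2 * pairMass α f e.2 e.1 - pairMass α f e.1 e.2) := by
  rw [← integral_move_sub hα hf, ← integral_const_mul]
  rfl

theorem hasSum_integral_generator (hα : ∀ x, 0 < α x ∧ α x < 1) {P : S → S → ℝ}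
    (hP : IsDoublySubstochastic P) {f g : C(Config S, ℝ)} (hfg : (f, g) ∈ pregeneratorGraph P) :
    HasSum (fun e : S × S => P e.1 e.2 *
      (odds α e.1 / odds α e.2 * pairMass α f e.2 e.1 - pairMass α f e.1 e.2))
      (∫ η, g η ∂productMeasure α) := by
  have h := hasSum_integral_jumpOp (μ := productMeasure α) hP hfg 1
  simp only [ContinuousMap.one_apply, one_mul, integral_jumpOp hα P hfg.1] at h
  exact h

/-- A product measure is stationary precisely when the mean of the generator vanishes on functions
of finitely many coordinates. -/
theorem isStationary_productMeasure_iff {P : S → S → ℝ} (hP : IsDoublySubstochastic P)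
    {T : OperatorFamily S} (hT : IsExclusionSemigroup P T) (hα : ∀ x, 0 < α x ∧ α x < 1) :
    IsStationary T (productMeasure α) ↔ ∀ f : C(Config S, ℝ), IsCylinder f →
      ∑' e : S × S, P e.1 e.2 *
        (odds α e.1 / odds α e.2 * pairMass α f e.2 e.1 - pairMass α f e.1 e.2) = 0 := by
  rw [hT.isStationary_iff hP]
  constructor
  · intro h f hf
    have hfg := IsCylinder.mem_pregeneratorGraph hP hf
    rw [(hasSum_integral_generator hα hP hfg).tsum_eq]
    exact h _ hfg
  · rintro h ⟨f, g⟩ hfg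
    rw [← (hasSum_integral_generator hα hP hfg).tsum_eq]
    exact h f hfg.1

/-- Of all bonds, only `(x, y)` leads from `{η x = 1, η y = 0}` to `{η x = 0, η y = 1}`. -/
theorem occ_mul_vac_mul_move_sub {S : Type*} [DecidableEq S] (x y : S) (hxy : x ≠ y)
    (e : S × S) (η : Config S) :
    occ (η x) * vac (η y) * (occ (move e η y) * vac (move e η x) - occ (η y) * vac (η x)) =
      if e = (x, y) then occ (η x) * vac (η y) else 0 := by
  by_cases h : η x = true ∧ η y = false
  swap
  · cases h1 : η x <;> cases h2 : η y <;> simp_all [occ, vac]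
  obtain ⟨hx, hy⟩ := h
  by_cases he : e = (x, y)
  · subst he
    simp [move, exchange, hx, hy, occ, vac]
  rw [if_neg he]
  have h0 : ¬ (move e η y = true ∧ move e η x = false) := by
    rintro ⟨h1, h2⟩
    apply he
    have hye : y = e.2 := by
      by_contra hne
      by_cases hy1 : y = e.1
      · by_cases hm : η e.1 = true ∧ η e.2 = false
        · rw [← hy1, hy] at hm; simp at hm
        · rw [move, if_neg hm, hy] at h1; simp at h1
      · rw [move_apply_of_ne hy1 hne, hy] at h1; simp at h1
    have hxe : x = e.1 := by
      by_contra hne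
      rw [move_apply_of_ne hne (hye ▸ hxy), hx] at h2; simp at h2
    rw [hxe, hye]
  cases h1 : move e η y <;> cases h2 : move e η x <;> simp_all [occ, vac]

/-- Reversible product measures satisfy the detailed balance equations. -/
theorem IsReversible.detailed_balance {P : S → S → ℝ} (hP : IsDoublySubstochastic P)
    {T : OperatorFamily S} (hT : IsExclusionSemigroup P T)
    (hrev : IsReversible T (productMeasure α)) {x y : S} (hxy : x ≠ y) :
    P x y * (α x * (1 - α y)) = P y x * (α y * (1 - α x)) := by
  have hcyl : ∀ x y : S, IsCylinder (siteFun x occ * siteFun y vac) := fun x y =>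
    ⟨{x, y}, mul_mem_dependingOn (siteFun_mem_dependingOn (by simp) _)
      (siteFun_mem_dependingOn (by simp) _)⟩
  have key : ∀ {x y : S}, x ≠ y → ∀ {g' : C(Config S, ℝ)},
      (siteFun y occ * siteFun x vac, g') ∈ pregeneratorGraph P →
      ∫ η, (siteFun x occ * siteFun y vac) η * g' η ∂productMeasure α =
        P x y * (α x * (1 - α y)) := by
    intro x y hxy g' hg
    have h := hasSum_integral_jumpOp (μ := productMeasure α) hP hg (siteFun x occ * siteFun y vac)
    have h1 : ∀ e, ∫ η, (siteFun x occ * siteFun y vac) η *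
        jumpOp P e (siteFun y occ * siteFun x vac) η ∂productMeasure α =
          if e = (x, y) then P x y * (α x * (1 - α y)) else 0 := by
      intro e
      have h2 : ∀ η, (siteFun x occ * siteFun y vac) η *
          jumpOp P e (siteFun y occ * siteFun x vac) η =
            P e.1 e.2 * if e = (x, y) then occ (η x) * vac (η y) else 0 := fun η => by
        rw [← occ_mul_vac_mul_move_sub x y hxy e η, jumpOp_apply]
        simp only [ContinuousMap.mul_apply, siteFun_apply]
        ring
      rw [integral_congr_ae (Eventually.of_forall h2), integral_const_mul]
      split_ifs with he
      · subst he
        have h3 := integral_siteFun_mul_siteFun_mul (α := α) (A := ∅) hxy (by simp) (by simp)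
          occ vac (f := 1) fun _ _ _ => rfl
        simp only [ContinuousMap.one_apply, mul_one, integral_const, probReal_univ, smul_eq_mul,
          siteMean_occ, siteMean_vac] at h3
        rw [h3]
      · simp
    simp only [h1] at h
    exact h.unique (hasSum_ite_eq _ _)
  have hf := IsCylinder.mem_pregeneratorGraph hP (hcyl x y)
  have hg := IsCylinder.mem_pregeneratorGraph hP (hcyl y x)
  rw [← key hxy hg, ← key (Ne.symm hxy) hf]
  exact hrev.integral_mul_eq hT hf hg

end ProductMeasure

/-! ### The stationarity criterion on the lattice -/

section Lattice

variable {d : ℕ} {p : Lattice d → ℝ} {α : Lattice d → unitInterval} {v : Fin d → ℝ}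

theorem isDoublySubstochastic_translationKernel (hp : ∀ z, 0 ≤ p z) (hp1 : HasSum p 1) :
    IsDoublySubstochastic (translationKernel p) := by
  have h1 : ∑' z, ENNReal.ofReal (p z) = 1 := by
    rw [← ENNReal.ofReal_tsum_of_nonneg hp hp1.summable, hp1.tsum_eq, ENNReal.ofReal_one]
  refine ⟨fun x y => hp _, fun x => le_of_eq ?_, fun y => le_of_eq ?_⟩
  · exact ((Equiv.subRight x).tsum_eq fun z => ENNReal.ofReal (p z)).trans h1
  · exact ((Equiv.subLeft y).tsum_eq fun z => ENNReal.ofReal (p z)).trans h1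

theorem odds_pos {S : Type*} {α : S → unitInterval} (hα : ∀ x, 0 < α x ∧ α x < 1) (x : S) :
    0 < odds α x := by
  have h1 : (α x : ℝ) < 1 := (hα x).2
  have h0 : (0 : ℝ) < α x := (hα x).1
  exact div_pos h0 (sub_pos.2 h1)

theorem eq_of_odds_eq {S : Type*} {α : S → unitInterval} (hα : ∀ x, 0 < α x ∧ α x < 1) {x y : S}
    (h : odds α x = odds α y) : (α x : ℝ) = α y := by
  have h1 : (α x : ℝ) < 1 := (hα x).2
  have h2 : (α y : ℝ) < 1 := (hα y).2
  rw [odds, odds, div_eq_div_iff (by linarith) (by linarith)] at h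
  linarith

theorem pairing_sub (x y : Lattice d) : pairing (x - y) v = pairing x v - pairing y v := by
  simp [pairing, sub_mul]

theorem pairing_neg (x : Lattice d) : pairing (-x) v = -pairing x v := by
  simp [pairing]

theorem odds_div (hα : ∀ x, 0 < α x ∧ α x < 1)
    (hv : ∀ x, odds α x = odds α 0 * Real.exp (pairing x v)) (x y : Lattice d) :
    odds α x / odds α y = Real.exp (pairing (x - y) v) := by
  have h0 := (odds_pos hα 0).ne'
  rw [hv x, hv y, mul_div_mul_left _ _ h0, pairing_sub, Real.exp_sub]

theorem pairMass_sub (f : C(Config (Lattice d), ℝ)) {x y : Lattice d}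
    (h : (α x : ℝ) = α y) : pairMass α f y x - pairMass α f x y =
      ∫ η, centred (α y) (η y) * f η ∂productMeasure α -
        ∫ η, centred (α x) (η x) * f η ∂productMeasure α := by
  have h1 := integral_sub (integrable_config (μ := productMeasure α)
      (siteFun y occ * siteFun x vac * f)) (integrable_config (siteFun x occ * siteFun y vac * f))
  have h2 := integral_sub (integrable_config (μ := productMeasure α)
      (siteFun y (centred (α y)) * f)) (integrable_config (siteFun x (centred (α x)) * f))
  refine h1.symm.trans (Eq.trans ?_ h2)
  refine integral_congr_ae (Eventually.of_forall fun η => ?_)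
  simp only [ContinuousMap.mul_apply, siteFun_apply, centred, h]
  cases η x <;> cases η y <;> simp [occ, vac] <;> ring

/-- The change of variables `(x, y) ↦ (y - x, x)`. -/
def shearFst {G : Type*} [AddCommGroup G] : G × G ≃ G × G where
  toFun e := (e.2 - e.1, e.1)
  invFun e := (e.2, e.1 + e.2)
  left_inv e := by simp
  right_inv e := by simp

/-- The change of variables `(x, y) ↦ (y - x, y)`. -/
def shearSnd {G : Type*} [AddCommGroup G] : G × G ≃ G × G where
  toFun e := (e.2 - e.1, e.2)
  invFun e := (e.2 - e.1, e.2)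
  left_inv e := by simp
  right_inv e := by simp

/-- If `r` is summable and `m` has finite support, then `∑ r(y - x) (m y - m x) = 0`: both parts
have the sum `(∑ r) (∑ m)`. -/
theorem tsum_mul_sub_eq_zero {r m : Lattice d → ℝ} (hr : Summable r) (A : Finset (Lattice d))
    (hm : ∀ x ∉ A, m x = 0) :
    ∑' e : Lattice d × Lattice d, r (e.2 - e.1) * (m e.2 - m e.1) = 0 := by
  have hm' : Summable m := summable_of_ne_finset_zero (s := A) hm
  have hs : Summable fun z : Lattice d × Lattice d => r z.1 * m z.2 :=
    summable_mul_of_summable_norm hr.norm hm'.norm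
  have h1 : Summable fun e : Lattice d × Lattice d => r (e.2 - e.1) * m e.1 :=
    (shearFst.summable_iff (f := fun z : Lattice d × Lattice d => r z.1 * m z.2)).2 hs
  have h2 : Summable fun e : Lattice d × Lattice d => r (e.2 - e.1) * m e.2 :=
    (shearSnd.summable_iff (f := fun z : Lattice d × Lattice d => r z.1 * m z.2)).2 hs
  have e1 : ∑' e : Lattice d × Lattice d, r (e.2 - e.1) * m e.1 =
      ∑' z : Lattice d × Lattice d, r z.1 * m z.2 :=
    shearFst.tsum_eq fun z : Lattice d × Lattice d => r z.1 * m z.2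
  have e2 : ∑' e : Lattice d × Lattice d, r (e.2 - e.1) * m e.2 =
      ∑' z : Lattice d × Lattice d, r z.1 * m z.2 :=
    shearSnd.tsum_eq fun z : Lattice d × Lattice d => r z.1 * m z.2
  simp only [mul_sub]
  rw [h2.tsum_sub h1, e1, e2, sub_self]

theorem isStationary_of_forall_eq (hp : ∀ z, 0 ≤ p z) (hp1 : HasSum p 1)
    {T : OperatorFamily (Lattice d)} (hT : IsExclusionSemigroup (translationKernel p) T)
    (hα : ∀ x, 0 < α x ∧ α x < 1) (hv : ∀ x, odds α x = odds α 0 * Real.exp (pairing x v))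
    (h : ∀ z, pairing z v ≠ 0 → p z = Real.exp (pairing z v) * p (-z)) :
    IsStationary T (productMeasure α) := by
  have hP := isDoublySubstochastic_translationKernel hp hp1
  rw [isStationary_productMeasure_iff hP hT hα]
  intro f hf
  set k : Lattice d × Lattice d → ℝ := fun e => translationKernel p e.1 e.2 *
    (odds α e.1 / odds α e.2 * pairMass α f e.2 e.1 - pairMass α f e.1 e.2) with hk
  have hks : Summable k :=
    (hasSum_integral_generator hα hP (IsCylinder.mem_pregeneratorGraph hP hf)).summable
  set N : Set (Lattice d × Lattice d) := {e | pairing (e.2 - e.1) v ≠ 0} with hN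
  -- off the hyperplane orthogonal to `v`, the two orientations of a bond cancel
  have h1 : ∑' e, N.indicator k e = 0 := by
    have hsw : ∀ e, N.indicator k (Equiv.prodComm _ _ e) = -N.indicator k e := by
      rintro ⟨x, y⟩
      have hneg : pairing (x - y) v = -pairing (y - x) v := by rw [← pairing_neg, neg_sub]
      by_cases hxy : pairing (y - x) v = 0
      · simp [Set.indicator, hN, hxy, hneg]
      · have hmem : ((x, y) : Lattice d × Lattice d) ∈ N := hxy
        have hmem' : ((y, x) : Lattice d × Lattice d) ∈ N := by
          simpa [hN, hneg] using hxy
        rw [Equiv.prodComm_apply, Prod.swap_prod_mk, Set.indicator_of_mem hmem,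
          Set.indicator_of_mem hmem']
        simp only [hk, translationKernel]
        have := h _ hxy
        rw [neg_sub] at this
        rw [this, odds_div hα hv, odds_div hα hv, hneg, Real.exp_neg]
        have := Real.exp_ne_zero (pairing (y - x) v)
        field_simp
        ring
    have := (Equiv.prodComm (Lattice d) (Lattice d)).tsum_eq (N.indicator k)
    simp only [hsw, tsum_neg] at this
    linarith
  -- on the hyperplane, the contributions telescope
  have h2 : ∑' e, Nᶜ.indicator k e = 0 := by
    obtain ⟨A, hA⟩ := hf.mem_dependingOn
    set r : Lattice d → ℝ := Set.indicator {z | pairing z v = 0} p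
    set m : Lattice d → ℝ := fun x => ∫ η, centred (α x) (η x) * f η ∂productMeasure α with hm
    have hr : Summable r := hp1.summable.indicator _
    refine (tsum_congr fun e => ?_).trans (tsum_mul_sub_eq_zero hr A (m := m) fun x hx => ?_)
    · by_cases he : pairing (e.2 - e.1) v = 0
      · have hodds : odds α e.1 / odds α e.2 = 1 := by
          rw [odds_div hα hv, ← neg_sub, pairing_neg, he, neg_zero, Real.exp_zero]
        have hαe := eq_of_odds_eq hα ((div_eq_one_iff_eq (odds_pos hα e.2).ne').1 hodds)
        rw [Set.indicator_of_mem (by simpa [hN] using he)]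
        simp only [hk, hm, hodds, one_mul, pairMass_sub f hαe, r, translationKernel]
        rw [Set.indicator_of_mem (by simpa using he)]
      · rw [Set.indicator_of_notMem (by simpa [hN] using he)]
        simp only [r]
        rw [Set.indicator_of_notMem (by simpa using he), zero_mul]
    · rw [hm]
      dsimp only
      rw [integral_siteFun_mul hx _ hA, siteMean_centred, zero_mul]
  have hsum := (hks.indicator N).tsum_add (hks.indicator Nᶜ)
  rw [h1, h2, add_zero] at hsum
  rw [← hsum]
  exact tsum_congr fun e => (congrFun (Set.indicator_self_add_compl N k) e).symm

end Lattice

section Bond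

variable {S : Type*} [Countable S] [DecidableEq S] {α : S → unitInterval}

/-- A site that does not take part in the jump contributes its mean, which vanishes for a centred
occupation variable. -/
theorem integral_jumpOp_centred_mul_eq_zero (P : S → S → ℝ) {a b : S} (hab : a ≠ b) {e : S × S}
    (h1 : a ≠ e.1) (h2 : a ≠ e.2) :
    ∫ η, jumpOp P e (siteFun a (centred (α a)) * siteFun b (centred (α b))) η ∂productMeasure α
      = 0 := by
  have h : ∀ η, jumpOp P e (siteFun a (centred (α a)) * siteFun b (centred (α b))) η =
      centred (α a) (η a) * jumpOp P e (siteFun b (centred (α b))) η := fun η => by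
    simp only [jumpOp_apply, ContinuousMap.mul_apply, siteFun_apply, move_apply_of_ne h1 h2]
    ring
  rw [integral_congr_ae (Eventually.of_forall h),
    integral_siteFun_mul (A := {b, e.1, e.2}) (by simp [hab, h1, h2]), siteMean_centred, zero_mul]
  exact jumpOp_mem_dependingOn P (by simp) (by simp) (siteFun_mem_dependingOn (by simp) _)

theorem pairMass_centred_mul {a b : S} (hab : a ≠ b) :
    pairMass α (siteFun a (centred (α a)) * siteFun b (centred (α b))) a b =
      -(α a * (1 - α a) * (α b * (1 - α b))) := by
  have h := integral_siteFun_mul_siteFun_mul (α := α) (A := ∅) hab (by simp) (by simp)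
    (fun c => occ c * centred (α a) c) (fun c => vac c * centred (α b) c) (f := 1) fun _ _ _ => rfl
  simp only [ContinuousMap.one_apply, mul_one, integral_const, probReal_univ, smul_eq_mul] at h
  rw [pairMass]
  refine Eq.trans (integral_congr_ae (Eventually.of_forall fun η => ?_)) (h.trans ?_)
  · simp only [ContinuousMap.mul_apply, siteFun_apply]
    ring
  · simp only [siteMean, centred, occ, vac, if_true, Bool.false_eq_true, if_false]
    ring

/-- Testing stationarity on the product of two centred occupation variables isolates a single
bond. -/
theorem IsStationary.bond_balance {P : S → S → ℝ} (hP : IsDoublySubstochastic P)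
    {T : OperatorFamily S} (hT : IsExclusionSemigroup P T) (hα : ∀ x, 0 < α x ∧ α x < 1)
    (h : IsStationary T (productMeasure α)) {a b : S} (hab : a ≠ b) :
    P a b * (odds α a / odds α b - 1) + P b a * (odds α b / odds α a - 1) = 0 := by
  set f := siteFun a (centred (α a)) * siteFun b (centred (α b)) with hf
  have hcyl : IsCylinder f := ⟨{a, b}, mul_mem_dependingOn (siteFun_mem_dependingOn (by simp) _)
    (siteFun_mem_dependingOn (by simp) _)⟩
  have h0 := (isStationary_productMeasure_iff hP hT hα).1 h f hcyl
  have hcomm : f = siteFun b (centred (α b)) * siteFun a (centred (α a)) := mul_comm _ _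
  have hz : ∀ e ∉ ({(a, b), (b, a)} : Finset (S × S)), P e.1 e.2 *
      (odds α e.1 / odds α e.2 * pairMass α f e.2 e.1 - pairMass α f e.1 e.2) = 0 := by
    rintro ⟨x, y⟩ he
    rw [← integral_jumpOp hα P hcyl (x, y)]
    by_cases ha : a ≠ x ∧ a ≠ y
    · exact integral_jumpOp_centred_mul_eq_zero P hab ha.1 ha.2
    by_cases hb : b ≠ x ∧ b ≠ y
    · rw [hcomm]
      exact integral_jumpOp_centred_mul_eq_zero P hab.symm hb.1 hb.2
    · exfalso
      apply he
      simp only [Finset.mem_insert, Finset.mem_singleton, Prod.mk.injEq]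
      grind
  rw [tsum_eq_sum hz, Finset.sum_pair (by simp [hab])] at h0
  have hab1 := pairMass_centred_mul (α := α) hab
  have hba1 := pairMass_centred_mul (α := α) hab.symm
  rw [← hf] at hab1
  rw [← hcomm] at hba1
  simp only [hab1, hba1] at h0
  have hpos : ∀ x, (0 : ℝ) < α x * (1 - α x) := fun x => by
    have h1 : (α x : ℝ) < 1 := (hα x).2
    have h0 : (0 : ℝ) < α x := (hα x).1
    exact mul_pos h0 (sub_pos.2 h1)
  have hne := (mul_pos (hpos a) (hpos b)).ne'
  refine (mul_eq_zero.1 (?_ : (α a * (1 - α a) * (α b * (1 - α b)) : ℝ) * _ = 0)).resolve_left hne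
  linear_combination -h0

end Bond

section Criterion

variable {d : ℕ} {p : Lattice d → ℝ} {α : Lattice d → unitInterval} {v : Fin d → ℝ}

theorem IsStationary.eq_exp_mul (hp : ∀ z, 0 ≤ p z) (hp1 : HasSum p 1)
    {T : OperatorFamily (Lattice d)} (hT : IsExclusionSemigroup (translationKernel p) T)
    (hα : ∀ x, 0 < α x ∧ α x < 1) (hv : ∀ x, odds α x = odds α 0 * Real.exp (pairing x v))
    (h : IsStationary T (productMeasure α)) {z : Lattice d} (hz : pairing z v ≠ 0) :
    p z = Real.exp (pairing z v) * p (-z) := by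
  have hz0 : (0 : Lattice d) ≠ z := fun h0 => hz (by simp [← h0, pairing])
  have hb := h.bond_balance (isDoublySubstochastic_translationKernel hp hp1) hT hα hz0
  rw [odds_div hα hv, odds_div hα hv, translationKernel, translationKernel, zero_sub, sub_zero,
    pairing_neg, Real.exp_neg] at hb
  set r := Real.exp (pairing z v) with hr
  have hr0 : r ≠ 0 := Real.exp_ne_zero _
  have hr1 : r - 1 ≠ 0 := fun h => hz (Real.exp_eq_one_iff _ |>.1 (sub_eq_zero.1 h))
  have : (r - 1) * (r * p (-z) - p z) = 0 := by
    field_simp at hb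
    linear_combination hb
  linarith [(mul_eq_zero.1 this).resolve_left hr1]

/-! ### Nearest neighbour walks in the plane -/

theorem nearestNeighbour_neg (a b : Fin d → ℝ) (z : Lattice d) :
    nearestNeighbour a b (-z) = nearestNeighbour b a z := by
  refine Finset.sum_congr rfl fun j _ => ?_
  simp only [neg_eq_iff_eq_neg, neg_neg]
  exact add_comm (G := ℝ) _ _

theorem hasSum_nearestNeighbour (a b : Fin d → ℝ) :
    HasSum (nearestNeighbour a b) (∑ i, (a i + b i)) := by
  have h : ∀ i, HasSum (fun z : Lattice d => (if z = Pi.single i 1 then a i else 0) +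
      if z = -Pi.single i 1 then b i else 0) (a i + b i) := fun i =>
    (hasSum_ite_eq _ _).add (hasSum_ite_eq _ _)
  exact hasSum_sum fun i _ => h i

theorem nearestNeighbour_nonneg {a b : Fin d → ℝ} (ha : ∀ i, 0 ≤ a i) (hb : ∀ i, 0 ≤ b i)
    (z : Lattice d) : 0 ≤ nearestNeighbour a b z :=
  Finset.sum_nonneg fun i _ => add_nonneg (by split_ifs <;> simp [ha]) (by split_ifs <;> simp [hb])

theorem nearestNeighbour_of_ne_zero (a b : Fin d → ℝ) {z : Lattice d} {i : Fin d} (hz : z i ≠ 0) :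
    nearestNeighbour a b z = (if z = Pi.single i 1 then a i else 0) +
      if z = -Pi.single i 1 then b i else 0 := by
  refine Finset.sum_eq_single i (fun j _ hj => ?_) (by simp)
  have h1 : z ≠ Pi.single j 1 := fun h => hz (by simp [h, hj.symm])
  have h2 : z ≠ -Pi.single j 1 := fun h => hz (by simp [h, hj.symm])
  simp [h1, h2]

theorem single_ne_neg_single (i : Fin d) : (Pi.single i 1 : Lattice d) ≠ -Pi.single i 1 := fun h =>
  by have := congrFun h i; simp at this

theorem nearestNeighbour_single (a b : Fin d → ℝ) (i : Fin d) :
    nearestNeighbour a b (Pi.single i 1) = a i := by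
  rw [nearestNeighbour_of_ne_zero (i := i) a b (by simp)]
  simp [single_ne_neg_single]

theorem IsHomogeneous.odds_eq (h : IsHomogeneous (productMeasure α)) (x : Lattice d) :
    odds α x = odds α 0 := by
  have h1 := integral_siteFun (α := α) 0 occ
  have hm : Measurable fun (η : Config (Lattice d)) y => η (y + x) :=
    measurable_pi_lambda _ fun y => measurable_pi_apply _
  rw [← h x, integral_map hm.aemeasurable (siteFun 0 occ).continuous.aestronglyMeasurable] at h1
  have h2 := integral_siteFun (α := α) x occ
  simp only [siteFun_apply, zero_add, siteMean_occ] at h1 h2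
  rw [odds, odds, ← h1, ← h2]

theorem exists_odds_eq {S : Type*} {o : S → ℝ} (ho : ∀ x, 0 < o x) :
    ∃ α : S → unitInterval, (∀ x, 0 < α x ∧ α x < 1) ∧ ∀ x, odds α x = o x := by
  have h0 : ∀ x, 0 < o x / (1 + o x) := fun x => div_pos (ho x) (by linarith [ho x])
  have h1 : ∀ x, o x / (1 + o x) < 1 := fun x => by
    rw [div_lt_one (by linarith [ho x])]
    linarith
  refine ⟨fun x => ⟨o x / (1 + o x), (h0 x).le, (h1 x).le⟩, fun x => ⟨h0 x, h1 x⟩, fun x => ?_⟩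
  have : 1 + o x ≠ 0 := by linarith [ho x]
  simp only [odds]
  field_simp
  simp

/-- For a planar nearest neighbour walk with drift in both directions, the product measure whose
odds grow geometrically in one of the directions is stationary, neither homogeneous nor
reversible. -/
theorem exists_isStationary_not_isHomogeneous_not_isReversible {a b : Fin 2 → ℝ}
    (ha : ∀ i, 0 < a i) (hb : ∀ i, 0 < b i) (hab : ∑ i, (a i + b i) = 1) (hne : ∀ i, a i ≠ b i)
    {T : OperatorFamily (Lattice 2)}
    (hT : IsExclusionSemigroup (translationKernel (nearestNeighbour a b)) T) (i : Fin 2) {c : ℝ}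
    (hc : 0 < c) :
    ∃ α : Lattice 2 → unitInterval, (∀ x, 0 < α x ∧ α x < 1) ∧
      (∀ x, odds α x = c * (a i / b i) ^ (x i)) ∧ IsStationary T (productMeasure α) ∧
        ¬ IsHomogeneous (productMeasure α) ∧ ¬ IsReversible T (productMeasure α) := by
  have hp := nearestNeighbour_nonneg (fun i => (ha i).le) (fun i => (hb i).le)
  have hp1 : HasSum (Exclusion.nearestNeighbour a b) 1 := hab ▸ hasSum_nearestNeighbour a b
  have hρ : 0 < a i / b i := div_pos (ha i) (hb i)
  obtain ⟨α, hα, ho⟩ := Exclusion.exists_odds_eq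
    (o := fun x : Lattice 2 => c * (a i / b i) ^ (x i)) fun x => by positivity
  refine ⟨α, hα, ho, ?_, fun h => ?_, fun h => ?_⟩
  · have hpair : ∀ x : Lattice 2,
        pairing x (Pi.single i (Real.log (a i / b i))) = x i * Real.log (a i / b i) := fun x => by
      simp [pairing, Pi.single_apply]
    have hexp : ∀ x : Lattice 2,
        Real.exp (pairing x (Pi.single i (Real.log (a i / b i)))) = (a i / b i) ^ (x i) :=
      fun x => by rw [hpair, mul_comm, Real.exp_mul, Real.exp_log hρ, Real.rpow_intCast]
    refine isStationary_of_forall_eq hp hp1 hT hα (v := Pi.single i (Real.log (a i / b i)))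
      (fun x => ?_) fun z hz => ?_
    · rw [ho, ho, hexp]; simp
    · rw [hpair] at hz
      have hzi : z i ≠ 0 := fun h0 => hz (by simp [h0])
      rw [hexp, nearestNeighbour_neg, nearestNeighbour_of_ne_zero _ _ hzi,
        nearestNeighbour_of_ne_zero _ _ hzi]
      have := (ha i).ne'
      have := (hb i).ne'
      by_cases h1 : z = Pi.single i 1
      · simp only [h1, if_true, single_ne_neg_single, if_false, Pi.single_eq_same,
          zpow_one, add_zero]
        field_simp
      by_cases h2 : z = -Pi.single i 1
      · simp only [h2, (single_ne_neg_single i).symm, if_true, if_false, Pi.neg_apply,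
          Pi.single_eq_same, zpow_neg_one, zero_add]
        field_simp
      · simp [h1, h2]
  · have := h.odds_eq (Pi.single i 1)
    rw [ho, ho] at this
    simp only [Pi.single_eq_same, zpow_one, Pi.zero_apply, zpow_zero] at this
    have h1 := mul_left_cancel₀ hc.ne' this
    exact hne i ((div_eq_one_iff_eq (hb i).ne').1 h1)
  · -- a step in the other direction does not change the density, but has a drift
    obtain ⟨j, hj⟩ : ∃ j : Fin 2, j ≠ i := exists_ne i
    have hb := h.detailed_balance (isDoublySubstochastic_translationKernel hp hp1) hT
      (x := 0) (y := Pi.single j 1) (fun h0 => by simpa using congrFun h0 j)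
    have ho' : odds α 0 = odds α (Pi.single j 1) := by
      rw [ho, ho]; simp [hj.symm]
    rw [translationKernel, translationKernel, sub_zero, zero_sub, nearestNeighbour_neg,
      nearestNeighbour_single, nearestNeighbour_single, eq_of_odds_eq hα ho'] at hb
    have h1 : (α (Pi.single j 1) : ℝ) < 1 := (hα _).2
    have h0 : (0 : ℝ) < α (Pi.single j 1) := (hα _).1
    exact hne j (mul_right_cancel₀ (mul_pos h0 (sub_pos.2 h1)).ne' hb)

end Criterion

end Exclusion
end

theorem theorem2 :
    -- the process is well defined, and the criterion for stationarity
    (∀ (d : ℕ) (p : Exclusion.Lattice d → ℝ), (∀ z, 0 ≤ p z) → HasSum p 1 →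
      (∃! T : Exclusion.OperatorFamily (Exclusion.Lattice d),
        Exclusion.IsExclusionSemigroup (Exclusion.translationKernel p) T) ∧
      ∀ T : Exclusion.OperatorFamily (Exclusion.Lattice d),
        Exclusion.IsExclusionSemigroup (Exclusion.translationKernel p) T →
        ∀ α : Exclusion.Lattice d → unitInterval, (∀ x, 0 < α x ∧ α x < 1) →
        ∀ v : Fin d → ℝ,
          (∀ x, Exclusion.odds α x = Exclusion.odds α 0 * Real.exp (Exclusion.pairing x v)) →
          (Exclusion.IsStationary T (Exclusion.productMeasure α) ↔
            ∀ z, Exclusion.pairing z v ≠ 0 →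
              p z = Real.exp (Exclusion.pairing z v) * p (-z))) ∧
    -- stationary product measures that are neither homogeneous nor reversible
    (∀ a b : Fin 2 → ℝ, (∀ i, 0 < a i) → (∀ i, 0 < b i) → ∑ i, (a i + b i) = 1 →
      (∀ i, a i ≠ b i) →
      ∀ T : Exclusion.OperatorFamily (Exclusion.Lattice 2),
        Exclusion.IsExclusionSemigroup
          (Exclusion.translationKernel (Exclusion.nearestNeighbour a b)) T →
        ∀ (i : Fin 2) (c : ℝ), 0 < c →
          ∃ α : Exclusion.Lattice 2 → unitInterval, (∀ x, 0 < α x ∧ α x < 1) ∧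
            (∀ x, Exclusion.odds α x = c * (a i / b i) ^ (x i)) ∧
            Exclusion.IsStationary T (Exclusion.productMeasure α) ∧
            ¬ Exclusion.IsHomogeneous (Exclusion.productMeasure α) ∧
            ¬ Exclusion.IsReversible T (Exclusion.productMeasure α)) := by
  refine ⟨fun d p hp hp1 => ⟨Exclusion.existsUnique_isExclusionSemigroup
    (Exclusion.isDoublySubstochastic_translationKernel hp hp1), fun T hT α hα v hv =>
      ⟨fun h z hz => h.eq_exp_mul hp hp1 hT hα hv hz,
        Exclusion.isStationary_of_forall_eq hp hp1 hT hα hv⟩⟩,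
    fun a b ha hb hab hne T hT i c hc =>
      Exclusion.exists_isStationary_not_isHomogeneous_not_isReversible ha hb hab hne hT i hc⟩
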